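/- Let $\bar s\in(0,+\infty]$, $\mu\in\mathbb R$ (the depreciation rate; $\mu>0$ in the model), $\rho>0$ (the discount rate), $q_0,\beta_0\in\mathbb R$, and let $\alpha,q_1,\beta_1$ be real functions of the age $s$. Elements of $H^1$ are identified with their continuous representatives. Assume: 1. $\alpha,q_1\in H^1(0,\bar s)$; moreover $\beta_1\in H^1(0,\bar s)$ if $\bar s<\infty$, and $\beta_1\in H^1(0,L)$ for every finite $L$ if $\bar s=\infty$; 2. $\alpha\ge0$, $q_1\ge 0$ and $\beta_1\ge\epsilon$ for some constant $\epsilon>0$; 3. the weak derivatives satisfy $\alpha'\le0$, $q_1'\le 0$, $\beta_1'\le0$ a.e.; 4. $\alpha(\bar s)=0$ if $\bar s<\infty$ (if $\bar s=\infty$, $\alpha$ vanishes at infinity automatically), $q_0\ge q_1(0^+)$ and $\beta_0\ge\beta_1(0^+)$; 5. if $\bar s=+\infty$, then $\rho>-\mu$. Let $X=L^2(0,\bar s)$ and $U=\mathbb R\times X$ with $|(u_0,u_1)|=|u_0|+|u_1|_X$. Let $A f=-f'-\mu f$ on $D(A)=\{f\in H^1(0,\bar s): f(0)=0\}$, which generates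 the $C_0$-semigroup $[e^{tA}f](s)=e^{-\mu t}f(s-t)\chi_{[t,\bar s]}(s)$ on $X$. Its adjoint semigroup is $[e^{tA^*}f](s)=e^{-\mu t}f(s+t)\chi_{[0,\bar s-t]}(s)$, with $D(A^*)=\{f\in H^1(0,\bar s): f(\bar s)=0\}$ (and $D(A^*)=H^1(0,\infty)$ if $\bar s=\infty$). For an initial datum $z_0=x\in X$ and a control $u=(u_0,u_1)\in L^2_\rho(0,\infty;U)$, i.e. $u$ measurable with $\int_0^\infty e^{-\rho t}|u(t)|^2dt<\infty$, let $y=y^{x,u}\in C([0,\infty);X)$, $y(t)=z(t,\cdot)$, be the mild solution of $$\partial_t z+\partial_s z=-\mu z+u_1,\qquad z(t,0)=u_0(t),\qquad z(0,s)=z_0(s),$$ that is, $y(t)=e^{tA}x+\int_0^te^{(t-\tau)A}\big(u_0(\tau)\delta_0+u_1(\tau)\big)d\tau$ in $D(A^*)'$ for all $t\ge0$, where $e^{tA}$ is extended to $D(A^*)'$ as the transpose of $e^{tA^*}|_{D(A^*)}$. Put $$J(x;u)=\int_0^\infty e^{-\rho t}\Big[\int_0^{\bar s}\big(\alpha\,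 y(t)-q_1u_1(t)-\beta_1u_1(t)^2\big)ds-q_0u_0(t)-\beta_0u_0(t)^2\Big]dt,\qquad V(x)=\sup_{u\in L^2_\rho(0,\infty;U)}J(x;u).$$ Define $\bar\alpha(s)=\int_s^{\bar s}e^{-(\rho+\mu)(\sigma-s)}\alpha(\sigma)\,d\sigma$ and $$v(x)=\langle\bar\alpha,x\rangle+\frac{(\bar\alpha(0)-q_0)^2}{4\rho\beta_0}+\int_0^{\bar s}\frac{(\bar\alpha(s)-q_1(s))^2}{4\rho\beta_1(s)}\,ds .$$ **Theorem.** For every $x=z_0\in X$ and every admissible control $u$ the mild solution $y^{x,u}$ exists and is unique, and $J(x;u)$ is well defined and finite. Moreover: (i) $V(x)=v(x)$ for every $x\in X$. (ii) For every $x=z_0\in X$ the time-independent control $$u_0^*=\frac{\bar\alpha(0)-q_0}{2\beta_0},\qquad u_1^*(s)=\frac{\bar\alpha(s)-q_1(s)}{2\beta_1(s)}$$ (where $u_1^*\in X$) is optimal, every optimal control equals it for a.e. $t>0$, and the associated optimal trajectory is, for every $t\ge0$ and a.e. $s\in(0,\bar s)$, $$z^*(t,s)=\begin{cases}\displaystyle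 e^{-\mu t}z_0(s-t)+\int_0^te^{-\mu\sigma}\,\frac{\bar\alpha(s-\sigma)-q_1(s-\sigma)}{2\beta_1(s-\sigma)}\,d\sigma,& s\ge t,\\[2mm]\displaystyle e^{-\mu s}\,\frac{\bar\alpha(0)-q_0}{2\beta_0}+\int_0^se^{-\mu\sigma}\,\frac{\bar\alpha(s-\sigma)-q_1(s-\sigma)}{2\beta_1(s-\sigma)}\,d\sigma,& s<t.\end{cases}$$ -/

import Mathlib

open MeasureTheory Set

noncomputable section

namespace VintageCapital

/-- Lebesgue measure on the age interval `(0, sbar)`, where `sbar` may be `+∞`. -/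
def ageMeasure (sbar : EReal) : Measure ℝ :=
  volume.restrict {s : ℝ | 0 < s ∧ (s : EReal) < sbar}

/-- The state space `X = L²(0, sbar)`. -/
abbrev State (sbar : EReal) : Type := Lp ℝ 2 (ageMeasure sbar)

/-- `f` is the continuous representative, on the closed age interval `[0, sbar]` (on `[0, ∞)` if
`sbar = ∞`), of an element of `H¹(0, sbar)` whose weak derivative is `g`: both functions are in
`L²(0, sbar)` and `f` is a primitive of `g`. In particular `f 0` is the limit of `f` at `0+`. -/
def HasH1Deriv (sbar : EReal) (f g : ℝ → ℝ) : Prop :=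
  MemLp f 2 (ageMeasure sbar) ∧ MemLp g 2 (ageMeasure sbar) ∧
    ∀ s : ℝ, 0 ≤ s → (s : EReal) ≤ sbar → f s = f 0 + ∫ σ in (0 : ℝ)..s, g σ

/-- The condition `f(sbar) = 0`. It is void for `sbar = ∞`, where every function of `H¹(0, ∞)`
tends to zero at infinity. -/
def VanishesAtEnd (sbar : EReal) (f : ℝ → ℝ) : Prop :=
  ∀ L : ℝ, (L : EReal) = sbar → f L = 0

/-- The domain `D(A*) = {φ ∈ H¹(0, sbar) : φ(sbar) = 0}` of the adjoint of
`A f = - f' - mu f`, `D(A) = {f ∈ H¹(0, sbar) : f(0) = 0}`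
(its elements are given by their continuous representatives). -/
def DomAdjoint (sbar : EReal) (φ : ℝ → ℝ) : Prop :=
  (∃ g, HasH1Deriv sbar φ g) ∧ VanishesAtEnd sbar φ

/-- The adjoint semigroup `(e^{tA*} φ)(s) = e^{-mu t} φ(s + t) χ_{[0, sbar - t]}(s)`. -/
def adjointSemigroup (sbar : EReal) (mu t : ℝ) (φ : ℝ → ℝ) (s : ℝ) : ℝ :=
  open Classical in
  if ((s + t : ℝ) : EReal) ≤ sbar then Real.exp (-mu * t) * φ (s + t) else 0

/-- The control operator `B (u₀, u₁) = u₀ δ₀ + u₁` with values in `D(A*)'`, evaluated at `ψ`. -/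
def controlOp (sbar : EReal) (u : ℝ × State sbar) (ψ : ℝ → ℝ) : ℝ :=
  u.1 * ψ 0 + ∫ s, u.2 s * ψ s ∂(ageMeasure sbar)

/-- `y ∈ C([0, ∞); X)` is the mild solution of `y' = A y + B u`, `y(0) = x`, that is,
`y(t) = e^{tA} x + ∫₀ᵗ e^{(t - τ)A} B u(τ) dτ` in `D(A*)'` for all `t ≥ 0`. The extended semigroup
on `D(A*)'` is the transpose of the adjoint semigroup on `D(A*)`: the equation is written out by
evaluating both sides at the elements `φ` of `D(A*)`. -/
def IsMildSolution (sbar : EReal) (mu : ℝ) (x : State sbar) (u : ℝ → ℝ × State sbar)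
    (y : ℝ → State sbar) : Prop :=
  ContinuousOn y (Ici 0) ∧
    ∀ t : ℝ, 0 ≤ t → ∀ φ : ℝ → ℝ, DomAdjoint sbar φ →
      ∫ s, y t s * φ s ∂(ageMeasure sbar) =
        (∫ s, x s * adjointSemigroup sbar mu t φ s ∂(ageMeasure sbar)) +
          ∫ τ in (0 : ℝ)..t, controlOp sbar (u τ) (adjointSemigroup sbar mu (t - τ) φ)

/-- The admissible controls `u = (u₀, u₁) ∈ L²_ρ(0, ∞; ℝ × X)`, with `|u| = |u₀| + |u₁|`. -/
def Admissible (sbar : EReal) (ρ : ℝ) (u : ℝ → ℝ × State sbar) : Prop :=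
  AEStronglyMeasurable u (volume.restrict (Ioi (0 : ℝ))) ∧
    IntegrableOn (fun t => Real.exp (-ρ * t) * (|(u t).1| + ‖(u t).2‖) ^ 2) (Ioi (0 : ℝ))

/-- The data of the control problem that enter the profit. -/
structure Coeffs where
  ρ : ℝ
  q0 : ℝ
  β0 : ℝ
  α : ℝ → ℝ
  q1 : ℝ → ℝ
  β1 : ℝ → ℝ

/-- The profit density at age `s`, in state `x` and with the control `w` in used capital goods. -/
def profitDensity {sbar : EReal} (c : Coeffs) (x w : State sbar) (s : ℝ) : ℝ :=
  c.α s * x s - c.q1 s * w s - c.β1 s * (w s) ^ 2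

/-- The instantaneous profit in state `x` with the control `u`. -/
def profitRate {sbar : EReal} (c : Coeffs) (x : State sbar) (u : ℝ × State sbar) : ℝ :=
  (∫ s, profitDensity c x u.2 s ∂(ageMeasure sbar)) - c.q0 * u.1 - c.β0 * u.1 ^ 2

/-- The discounted intertemporal profit of a trajectory `y` and a control `u`. -/
def payoff {sbar : EReal} (c : Coeffs) (y : ℝ → State sbar) (u : ℝ → ℝ × State sbar) : ℝ :=
  ∫ t in Ioi (0 : ℝ), Real.exp (-c.ρ * t) * profitRate c (y t) (u t)

/-- The integrals in the discounted profit converge. -/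
def PayoffFinite {sbar : EReal} (c : Coeffs) (y : ℝ → State sbar) (u : ℝ → ℝ × State sbar) :
    Prop :=
  (∀ t : ℝ, 0 ≤ t → Integrable (profitDensity c (y t) (u t).2) (ageMeasure sbar)) ∧
    IntegrableOn (fun t => Real.exp (-c.ρ * t) * profitRate c (y t) (u t)) (Ioi (0 : ℝ))

/-- The value function: the supremum, in `[-∞, ∞]`, of the profit over the admissible controls. -/
def valueFunction (sbar : EReal) (mu : ℝ) (c : Coeffs) (x : State sbar) : EReal :=
  sSup {r : EReal | ∃ u y, Admissible sbar c.ρ u ∧ IsMildSolution sbar mu x u y ∧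
    r = ((payoff c y u : ℝ) : EReal)}

/-- The control `u` is optimal at the initial state `x`. -/
def IsOptimal (sbar : EReal) (mu : ℝ) (c : Coeffs) (x : State sbar) (u : ℝ → ℝ × State sbar) :
    Prop :=
  Admissible sbar c.ρ u ∧ ∃ y, IsMildSolution sbar mu x u y ∧
    ((payoff c y u : ℝ) : EReal) = valueFunction sbar mu c x

/-- The assumptions on the coefficients. The age derivatives are weak derivatives. For
`sbar < ∞` the condition on `β1` is `β1 ∈ H¹(0, sbar)`; for `sbar = ∞` it is
`β1 ∈ H¹(0, L)` for all finite `L`, as a function bounded below by `ε > 0` is never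
in `L²(0, ∞)`. -/
structure CoeffAssumption (sbar : EReal) (c : Coeffs) : Prop where
  alpha_mem : ∃ g, HasH1Deriv sbar c.α g ∧ ∀ᵐ s ∂(ageMeasure sbar), g s ≤ 0
  q1_mem : ∃ g, HasH1Deriv sbar c.q1 g ∧ ∀ᵐ s ∂(ageMeasure sbar), g s ≤ 0
  beta1_mem : ∃ g, (∀ L : ℝ, 0 < L → (L : EReal) ≤ sbar → HasH1Deriv (L : EReal) c.β1 g) ∧
    ∀ᵐ s ∂(ageMeasure sbar), g s ≤ 0
  alpha_nonneg : ∀ s : ℝ, 0 ≤ s → (s : EReal) ≤ sbar → 0 ≤ c.α s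
  q1_nonneg : ∀ s : ℝ, 0 ≤ s → (s : EReal) ≤ sbar → 0 ≤ c.q1 s
  beta1_bound : ∃ ε : ℝ, 0 < ε ∧ ∀ s : ℝ, 0 ≤ s → (s : EReal) ≤ sbar → ε ≤ c.β1 s
  alpha_end : VanishesAtEnd sbar c.α
  q0_ge : c.q1 0 ≤ c.q0
  beta0_ge : c.β1 0 ≤ c.β0

/-- `ᾱ(s) = ∫_s^sbar e^{-(ρ + mu)(σ - s)} α(σ) dσ`. -/
def alphaBar (sbar : EReal) (mu : ℝ) (c : Coeffs) (s : ℝ) : ℝ :=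
  ∫ σ in {σ : ℝ | s < σ ∧ (σ : EReal) < sbar}, Real.exp (-(c.ρ + mu) * (σ - s)) * c.α σ

/-- The explicit function `v`. -/
def explicitValue (sbar : EReal) (mu : ℝ) (c : Coeffs) (x : State sbar) : ℝ :=
  (∫ s, alphaBar sbar mu c s * x s ∂(ageMeasure sbar)) +
    (alphaBar sbar mu c 0 - c.q0) ^ 2 / (4 * c.ρ * c.β0) +
    ∫ s, (alphaBar sbar mu c s - c.q1 s) ^ 2 / (4 * c.ρ * c.β1 s) ∂(ageMeasure sbar)

/-- `u₀* = (ᾱ(0) - q₀) / (2 β₀)`. -/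
def optBoundary (sbar : EReal) (mu : ℝ) (c : Coeffs) : ℝ :=
  (alphaBar sbar mu c 0 - c.q0) / (2 * c.β0)

/-- `u₁*(s) = (ᾱ(s) - q₁(s)) / (2 β₁(s))`. -/
def optDistributed (sbar : EReal) (mu : ℝ) (c : Coeffs) (s : ℝ) : ℝ :=
  (alphaBar sbar mu c s - c.q1 s) / (2 * c.β1 s)

/-- The explicit trajectory `z*(t, s)` with initial datum `z0`. -/
def optTrajectory (sbar : EReal) (mu : ℝ) (c : Coeffs) (z0 : ℝ → ℝ) (t s : ℝ) : ℝ :=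
  if t ≤ s then
    Real.exp (-mu * t) * z0 (s - t) +
      ∫ σ in (0 : ℝ)..t, Real.exp (-mu * σ) * optDistributed sbar mu c (s - σ)
  else
    Real.exp (-mu * s) * optBoundary sbar mu c +
      ∫ σ in (0 : ℝ)..s, Real.exp (-mu * σ) * optDistributed sbar mu c (s - σ)

end VintageCapital

end

/-!
Let `B` be the control operator, `B* ψ = (ψ(0), ψ)`, and let `k = B* (ρ - A*)⁻¹ α = (ᾱ(0), ᾱ)`.
By the mild equation the revenue `⟨α, y(t)⟩` is affine in the data: it is
`⟨e^{tA*} α, x⟩ + ∫₀ᵗ ⟨u(τ), B* e^{(t-τ)A*} α⟩ dτ`. This makes sense for every `α ∈ L²`, although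
`B*` is unbounded, since `r ↦ (e^{rA*} α)(0) = e^{-μr} α(r)` is itself in `L²`. The Laplace
transform at `ρ` turns the convolution into a product, so the discounted revenue is
`⟨ᾱ, x⟩ + ∫₀^∞ e^{-ρt} ⟨u(t), k⟩ dt`, and the controls at different times decouple. With
`q = (q₀, q₁)` and `Q(w) = β₀ w₀² + ∫ β₁ w₁²`, the maximizer of `⟨w, k - q⟩ - Q(w)` is `u*`, and
completing the square gives `J(x; u) = v(x) - ∫₀^∞ e^{-ρt} Q(u(t) - u*) dt`, from which the value
function and the unique optimal control are read off.
-/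

noncomputable section

namespace VintageCapital

open Filter Topology

/-- The age interval `(0, sbar)`. -/
def ageSet (sbar : EReal) : Set ℝ := {s : ℝ | 0 < s ∧ (s : EReal) < sbar}

lemma isOpen_ageSet (sbar : EReal) : IsOpen (ageSet sbar) :=
  isOpen_Ioi.inter (isOpen_Iio.preimage continuous_coe_real_ereal)

lemma measurableSet_ageSet (sbar : EReal) : MeasurableSet (ageSet sbar) :=
  (isOpen_ageSet sbar).measurableSet

lemma ageMeasure_eq (sbar : EReal) : ageMeasure sbar = volume.restrict (ageSet sbar) := rfl

lemma ae_mem_ageSet (sbar : EReal) : ∀ᵐ s ∂ageMeasure sbar, s ∈ ageSet sbar :=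
  ae_restrict_mem (measurableSet_ageSet sbar)

instance (sbar : EReal) : SigmaFinite (ageMeasure sbar) := by
  rw [ageMeasure_eq]; infer_instance

instance (sbar : EReal) : IsLocallyFiniteMeasure (ageMeasure sbar) := by
  rw [ageMeasure_eq]; infer_instance

lemma ae_coe_ne (sbar : EReal) : ∀ᵐ s : ℝ, (s : EReal) ≠ sbar := by
  have hsub : {s : ℝ | (s : EReal) = sbar}.Subsingleton := fun a ha b hb =>
    EReal.coe_injective (ha.trans hb.symm)
  simpa only [ae_iff, not_not, ne_eq] using hsub.measure_zero volume

section CoeFnIntegral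

variable {X Y : Type*} [MeasurableSpace X] [MeasurableSpace Y] {m : Measure X} {ν : Measure Y}
  [SigmaFinite m] {G : Y → Lp ℝ 2 m} {g : Y → X → ℝ}

lemma integrable_prod_restrict_of_ae_eq_coeFn (hG : Integrable G ν)
    (hg : AEStronglyMeasurable (fun p : Y × X => g p.1 p.2) (ν.prod m))
    (h : ∀ᵐ r ∂ν, G r =ᵐ[m] g r) {A : Set X} (hA : MeasurableSet A) (hmA : m A < ⊤) :
    Integrable (fun p : Y × X => g p.1 p.2) (ν.prod (m.restrict A)) := by
  have : IsFiniteMeasure (m.restrict A) := ⟨by simpa using hmA⟩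
  have hg' := hg.mono_measure (Measure.prod_mono (le_refl ν) (Measure.restrict_le_self (s := A)))
  refine (integrable_prod_iff hg').2 ⟨?_, ?_⟩
  · filter_upwards [h] with r hr
    exact (((Lp.memLp (G r)).restrict A).integrable one_le_two).congr (ae_restrict_of_ae hr)
  · refine (hG.norm.mul_const ‖indicatorConstLp 2 hA hmA.ne (1 : ℝ)‖).mono'
      hg'.norm.integral_prod_right' ?_
    filter_upwards [h] with r hr
    have hnorm : ∫ s in A, ‖g r s‖ ∂m = ∫ s in A, |G r| s ∂m := by
      refine integral_congr_ae (ae_restrict_of_ae ?_)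
      filter_upwards [hr, Lp.coeFn_abs (G r)] with s hs habs
      rw [habs, hs, Real.norm_eq_abs]
    have hinner := norm_inner_le_norm (𝕜 := ℝ) (indicatorConstLp 2 hA hmA.ne (1 : ℝ)) |G r|
    rwa [L2.inner_indicatorConstLp_one, ← hnorm, norm_abs_eq_norm, mul_comm] at hinner

lemma coeFn_integral_Lp [SFinite ν] (hG : Integrable G ν)
    (hg : AEStronglyMeasurable (fun p : Y × X => g p.1 p.2) (ν.prod m))
    (h : ∀ᵐ r ∂ν, G r =ᵐ[m] g r) :
    (∫ r, G r ∂ν : Lp ℝ 2 m) =ᵐ[m] fun s => ∫ r, g r s ∂ν := by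
  have hint := fun A => integrable_prod_restrict_of_ae_eq_coeFn hG hg h (A := A)
  refine ae_eq_of_forall_setIntegral_eq_of_sigmaFinite (fun A _ hmA => ?_)
    (fun A hA hmA => (hint A hA hmA).integral_prod_right) fun A hA hmA => ?_
  · have : IsFiniteMeasure (m.restrict A) := ⟨by simpa using hmA⟩
    exact ((Lp.memLp _).restrict A).integrable one_le_two
  · rw [← L2.inner_indicatorConstLp_one hA hmA.ne, ← integral_inner hG,
      integral_integral_swap (f := fun s r => g r s) (hint A hA hmA).swap]
    refine integral_congr_ae ?_
    filter_upwards [h] with r hr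
    rw [L2.inner_indicatorConstLp_one hA hmA.ne]
    exact integral_congr_ae (ae_restrict_of_ae hr)

end CoeFnIntegral

section Shift

/-- The right translation `f ↦ f (· - t)` of `L²(ℝ)`. -/
def translate (t : ℝ) : Lp ℝ 2 (volume : Measure ℝ) →ₗᵢ[ℝ] Lp ℝ 2 (volume : Measure ℝ) :=
  Lp.compMeasurePreservingₗᵢ ℝ (fun s : ℝ => s - t) (measurePreserving_sub_right volume t)

lemma ae_comp_sub_right {p : ℝ → Prop} (h : ∀ᵐ s : ℝ, p s) (t : ℝ) : ∀ᵐ s : ℝ, p (s - t) :=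
  (measurePreserving_sub_right (volume : Measure ℝ) t).quasiMeasurePreserving.ae h

lemma translate_coeFn (t : ℝ) (f : Lp ℝ 2 (volume : Measure ℝ)) :
    translate t f =ᵐ[volume] fun s => f (s - t) :=
  Lp.coeFn_compMeasurePreserving f (measurePreserving_sub_right volume t)

lemma continuous_translate :
    Continuous fun p : ℝ × Lp ℝ 2 (volume : Measure ℝ) => translate p.1 p.2 := by
  have h : Continuous fun p : ℝ × Lp ℝ 2 (volume : Measure ℝ) =>
      ContinuousMap.curry (⟨fun q : (ℝ × Lp ℝ 2 (volume : Measure ℝ)) × ℝ => q.2 - q.1.1,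
        by fun_prop⟩ : C((ℝ × Lp ℝ 2 (volume : Measure ℝ)) × ℝ, ℝ)) p :=
    ContinuousMap.continuous _
  exact Continuous.compMeasurePreservingLp (p := 2) continuous_snd h
    (fun p => measurePreserving_sub_right volume p.1) ENNReal.ofNat_ne_top

lemma translate_translate (s t : ℝ) (f : Lp ℝ 2 (volume : Measure ℝ)) :
    translate s (translate t f) = translate (s + t) f := by
  refine Lp.ext ?_
  filter_upwards [translate_coeFn s (translate t f), translate_coeFn (s + t) f,
    ae_comp_sub_right (translate_coeFn t f) s] with r h1 h2 h3
  rw [h1, h2, h3, sub_sub]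

lemma translate_zero (f : Lp ℝ 2 (volume : Measure ℝ)) : translate 0 f = f := by
  refine Lp.ext ?_
  filter_upwards [translate_coeFn 0 f] with r hr
  rw [hr, sub_zero]

lemma inner_translate (t : ℝ) (f g : Lp ℝ 2 (volume : Measure ℝ)) :
    inner ℝ (translate t f) g = inner ℝ f (translate (-t) g) := by
  rw [← (translate t).inner_map_map f, translate_translate, add_neg_cancel, translate_zero]

/-- Restriction from `L²(ℝ)` to `L²(0, sbar)`. -/
def restrictAge (sbar : EReal) : Lp ℝ 2 (volume : Measure ℝ) →L[ℝ] State sbar :=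
  LpToLpRestrictCLM ℝ ℝ ℝ volume 2 (ageSet sbar)

/-- Extension by zero from `L²(0, sbar)` to `L²(ℝ)`, obtained as the adjoint of restriction. -/
def extend (sbar : EReal) : State sbar →L[ℝ] Lp ℝ 2 (volume : Measure ℝ) :=
  ContinuousLinearMap.adjoint (restrictAge sbar)

variable {sbar : EReal}

lemma restrictAge_coeFn (f : Lp ℝ 2 (volume : Measure ℝ)) :
    restrictAge sbar f =ᵐ[ageMeasure sbar] f :=
  LpToLpRestrictCLM_coeFn ℝ (ageSet sbar) f

lemma inner_restrictAge (f : Lp ℝ 2 (volume : Measure ℝ)) (x : State sbar) :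
    inner ℝ (restrictAge sbar f) x = inner ℝ f (extend sbar x) :=
  (ContinuousLinearMap.adjoint_inner_right (restrictAge sbar) f x).symm

lemma norm_restrictAge_le : ‖restrictAge sbar‖ ≤ 1 :=
  ContinuousLinearMap.opNorm_le_bound _ zero_le_one fun f =>
    (norm_Lp_toLp_restrict_le (ageSet sbar) f).trans_eq (one_mul _).symm

lemma norm_extend_le : ‖extend sbar‖ ≤ 1 :=
  (LinearIsometryEquiv.norm_map ContinuousLinearMap.adjoint _).trans_le norm_restrictAge_le

lemma memLp_indicator_ageSet {f : ℝ → ℝ} (hf : MemLp f 2 (ageMeasure sbar)) :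
    MemLp ((ageSet sbar).indicator f) 2 volume :=
  (memLp_indicator_iff_restrict (measurableSet_ageSet sbar)).2 hf

lemma extend_eq_toLp {f : ℝ → ℝ} (hf : MemLp f 2 (ageMeasure sbar)) :
    extend sbar hf.toLp = (memLp_indicator_ageSet hf).toLp := by
  refine ext_inner_left ℝ fun g => ?_
  rw [← inner_restrictAge, L2.inner_def, L2.inner_def]
  refine (integral_indicator (measurableSet_ageSet sbar)).symm.trans (integral_congr_ae ?_)
  filter_upwards [(ae_restrict_iff' (measurableSet_ageSet sbar)).1 (restrictAge_coeFn g),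
    (ae_restrict_iff' (measurableSet_ageSet sbar)).1 hf.coeFn_toLp,
    (memLp_indicator_ageSet hf).coeFn_toLp] with s hg hfs hind
  rw [hind]
  by_cases hs : s ∈ ageSet sbar
  · rw [indicator_of_mem hs, indicator_of_mem hs, hg hs, hfs hs]
  · rw [indicator_of_notMem hs, indicator_of_notMem hs, inner_zero_right]

lemma extend_coeFn (x : State sbar) : extend sbar x =ᵐ[volume] (ageSet sbar).indicator x := by
  conv_lhs => rw [← Lp.toLp_coeFn x (Lp.memLp x), extend_eq_toLp]
  exact MemLp.coeFn_toLp _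

/-- The shift `x ↦ x (· - t)` of `L²(0, sbar)`, where `x` is extended by zero; `t` may have
either sign. -/
def ageShift (sbar : EReal) (t : ℝ) : State sbar →L[ℝ] State sbar :=
  restrictAge sbar ∘L (translate t).toContinuousLinearMap ∘L extend sbar

lemma ageShift_apply (t : ℝ) (x : State sbar) :
    ageShift sbar t x = restrictAge sbar (translate t (extend sbar x)) := rfl

lemma continuous_ageShift (x : State sbar) : Continuous fun t => ageShift sbar t x :=
  (restrictAge sbar).continuous.comp
    (continuous_translate.comp (continuous_id.prodMk continuous_const))

lemma norm_ageShift_le (t : ℝ) (x : State sbar) : ‖ageShift sbar t x‖ ≤ ‖x‖ := by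
  have hrestrict := (restrictAge sbar).le_of_opNorm_le norm_restrictAge_le
    (translate t (extend sbar x))
  have hextend := (extend sbar).le_of_opNorm_le norm_extend_le x
  rw [one_mul] at hrestrict hextend
  exact hrestrict.trans (((translate t).norm_map _).trans_le hextend)

lemma ageShift_toLp_coeFn (t : ℝ) {f : ℝ → ℝ} (hf : MemLp f 2 (ageMeasure sbar)) :
    ageShift sbar t hf.toLp =ᵐ[ageMeasure sbar] fun s => (ageSet sbar).indicator f (s - t) := by
  rw [ageShift_apply, extend_eq_toLp]
  filter_upwards [restrictAge_coeFn (translate t (memLp_indicator_ageSet hf).toLp),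
    ae_restrict_of_ae (translate_coeFn t (memLp_indicator_ageSet hf).toLp),
    ae_restrict_of_ae (ae_comp_sub_right (memLp_indicator_ageSet hf).coeFn_toLp t)]
    with s h1 h2 h3
  rw [h1, h2, h3]

lemma ageShift_coeFn (t : ℝ) (x : State sbar) :
    ageShift sbar t x =ᵐ[ageMeasure sbar] fun s => (ageSet sbar).indicator x (s - t) := by
  simpa only [Lp.toLp_coeFn] using ageShift_toLp_coeFn t (Lp.memLp x)

lemma ageShift_neg_eq_zero {r : ℝ} (hr : 0 < r) (h : r ∉ ageSet sbar) (x : State sbar) :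
    ageShift sbar (-r) x = 0 := by
  rw [Lp.eq_zero_iff_ae_eq_zero]
  filter_upwards [ageShift_coeFn (-r) x, ae_mem_ageSet sbar] with s hs hmem
  rw [hs, indicator_of_notMem, Pi.zero_apply]
  refine fun hmem' => h ⟨hr, lt_of_le_of_lt (EReal.coe_le_coe ?_) hmem'.2⟩
  linarith [hmem.1]

end Shift

section Pairing

variable {H : Type*} [NormedAddCommGroup H] [InnerProductSpace ℝ H]

/-- The pairing `⟨u, k⟩ = u₀ k₀ + ⟨u₁, k₁⟩` of `ℝ × H` with itself. The norm of `ℝ × H` is not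
Euclidean, so this is not the inner product of a Hilbert space structure on the product. -/
def pairing : (ℝ × H) →L[ℝ] (ℝ × H) →L[ℝ] ℝ :=
  (ContinuousLinearMap.mul ℝ ℝ).bilinearComp (.fst ℝ ℝ H) (.fst ℝ ℝ H) +
    (isBoundedBilinearMap_inner (𝕜 := ℝ) (E := H)).toContinuousLinearMap.bilinearComp
      (.snd ℝ ℝ H) (.snd ℝ ℝ H)

lemma pairing_apply (u k : ℝ × H) : pairing u k = u.1 * k.1 + inner ℝ u.2 k.2 := rfl

end Pairing

section MildSolution

variable {sbar : EReal}

/-- The control operator of the undamped transport equation (`mu = 0`), transposed and applied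
to the adjoint semigroup: `B* e^{rA*} φ = (φ(r), φ(· + r))`, with `φ` extended by zero. For `φ`
in `L²` the first component is only determined for almost every `r`. -/
def observation (φ : State sbar) (r : ℝ) : ℝ × State sbar :=
  (extend sbar φ r, ageShift sbar (-r) φ)

/-- The right-hand side of the mild equation at time `t`, tested with `φ`. It makes sense for
every `φ` in `L²(0, sbar)` and not only for `φ` in `D(A*)`. -/
def mildFunctional (mu : ℝ) (x : State sbar) (u : ℝ → ℝ × State sbar) (φ : State sbar) (t : ℝ) :
    ℝ :=
  inner ℝ x (Real.exp (-mu * t) • observation φ t).2 +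
    ∫ τ in (0 : ℝ)..t, pairing (u τ) (Real.exp (-mu * (t - τ)) • observation φ (t - τ))

lemma integral_mul_eq_inner (x : State sbar) {φ : ℝ → ℝ} {y : State sbar}
    (h : φ =ᵐ[ageMeasure sbar] y) : ∫ s, x s * φ s ∂ageMeasure sbar = inner ℝ x y := by
  rw [L2.inner_def]
  refine integral_congr_ae ?_
  filter_upwards [h] with s hs
  simp only [hs, RCLike.inner_apply, conj_trivial, mul_comm]

lemma adjointSemigroup_ae_eq (mu : ℝ) {t : ℝ} (ht : 0 ≤ t) {φ : ℝ → ℝ}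
    (hφ : MemLp φ 2 (ageMeasure sbar)) :
    adjointSemigroup sbar mu t φ =ᵐ[ageMeasure sbar]
      ((Real.exp (-mu * t) • observation hφ.toLp t).2 : State sbar) := by
  have hne : ∀ᵐ s ∂ageMeasure sbar, ((s - -t : ℝ) : EReal) ≠ sbar :=
    ae_restrict_of_ae (ae_comp_sub_right (ae_coe_ne sbar) (-t))
  filter_upwards [hne, ae_mem_ageSet sbar, ageShift_toLp_coeFn (-t) hφ,
    Lp.coeFn_smul (Real.exp (-mu * t)) (ageShift sbar (-t) hφ.toLp)] with s hne hs hshift hsmul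
  rw [Prod.smul_snd, observation, hsmul, Pi.smul_apply, hshift, adjointSemigroup]
  rw [sub_neg_eq_add] at hne ⊢
  by_cases h : ((s + t : ℝ) : EReal) ≤ sbar
  · have hmem : s + t ∈ ageSet sbar := ⟨add_pos_of_pos_of_nonneg hs.1 ht, h.lt_of_ne hne⟩
    rw [if_pos h, indicator_of_mem hmem, smul_eq_mul]
  · rw [if_neg h, indicator_of_notMem fun hmem => h hmem.2.le, smul_zero]

lemma adjointSemigroup_apply_zero (mu : ℝ) {φ : ℝ → ℝ} (hφ : MemLp φ 2 (ageMeasure sbar)) :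
    ∀ᵐ r : ℝ, 0 < r → adjointSemigroup sbar mu r φ 0 =
      (Real.exp (-mu * r) • observation hφ.toLp r).1 := by
  filter_upwards [ae_coe_ne sbar, (memLp_indicator_ageSet hφ).coeFn_toLp] with r hne hφr hr
  rw [Prod.smul_fst, observation, extend_eq_toLp, hφr, adjointSemigroup, zero_add]
  by_cases h : (r : EReal) ≤ sbar
  · have hmem : r ∈ ageSet sbar := ⟨hr, h.lt_of_ne hne⟩
    rw [if_pos h, indicator_of_mem hmem, smul_eq_mul]
  · rw [if_neg h, indicator_of_notMem fun hmem => h hmem.2.le, smul_zero]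

lemma controlOp_adjointSemigroup (mu : ℝ) {φ : ℝ → ℝ} (hφ : MemLp φ 2 (ageMeasure sbar)) :
    ∀ᵐ r : ℝ, 0 < r → ∀ u : ℝ × State sbar, controlOp sbar u (adjointSemigroup sbar mu r φ) =
      pairing u (Real.exp (-mu * r) • observation hφ.toLp r) := by
  filter_upwards [adjointSemigroup_apply_zero mu hφ] with r hr hr0 u
  rw [controlOp, hr hr0, integral_mul_eq_inner u.2 (adjointSemigroup_ae_eq mu hr0.le hφ),
    pairing_apply]

lemma DomAdjoint.memLp {φ : ℝ → ℝ} (h : DomAdjoint sbar φ) : MemLp φ 2 (ageMeasure sbar) :=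
  h.1.choose_spec.1

lemma mild_rhs_eq_mildFunctional (mu : ℝ) (x : State sbar) (u : ℝ → ℝ × State sbar) {t : ℝ}
    (ht : 0 ≤ t) {φ : ℝ → ℝ} (hφ : MemLp φ 2 (ageMeasure sbar)) :
    (∫ s, x s * adjointSemigroup sbar mu t φ s ∂ageMeasure sbar) +
        ∫ τ in (0 : ℝ)..t, controlOp sbar (u τ) (adjointSemigroup sbar mu (t - τ) φ) =
      mildFunctional mu x u hφ.toLp t := by
  rw [mildFunctional, integral_mul_eq_inner x (adjointSemigroup_ae_eq mu ht hφ)]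
  congr 1
  refine intervalIntegral.integral_congr_ae ?_
  have hae := (Measure.measurePreserving_sub_left (volume : Measure ℝ) t).quasiMeasurePreserving.ae
    (controlOp_adjointSemigroup mu hφ)
  filter_upwards [hae, Measure.ae_ne volume t] with τ hτ hne hmem
  rw [uIoc_of_le ht] at hmem
  exact hτ (sub_pos.2 (hmem.2.lt_of_ne hne)) (u τ)

lemma isMildSolution_iff {mu : ℝ} {x : State sbar} {u : ℝ → ℝ × State sbar} {y : ℝ → State sbar} :
    IsMildSolution sbar mu x u y ↔ ContinuousOn y (Ici 0) ∧ ∀ t, 0 ≤ t → ∀ φ,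
      ∀ hφ : DomAdjoint sbar φ, inner ℝ (y t) hφ.memLp.toLp =
        mildFunctional mu x u hφ.memLp.toLp t := by
  refine and_congr_right fun _ => forall₂_congr fun t ht => forall₂_congr fun φ hφ => ?_
  rw [mild_rhs_eq_mildFunctional mu x u ht hφ.memLp,
    integral_mul_eq_inner (y t) hφ.memLp.coeFn_toLp.symm]

/-- The controls for which the mild equation has a solution: locally square integrable on the
boundary and locally integrable in the distributed component. -/
structure LocallyAdmissible (u : ℝ → ℝ × State sbar) : Prop where
  fst : ∀ T, MemLp (fun t => (u t).1) 2 (volume.restrict (Ioc 0 T))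
  snd : ∀ T, IntegrableOn (fun t => (u t).2) (Ioc 0 T)

lemma memLp_exp_smul {E : Type*} [NormedAddCommGroup E] [NormedSpace ℝ E] {p : ENNReal}
    {f : ℝ → E} {T : ℝ} (hf : MemLp f p (volume.restrict (Ioc 0 T))) (l : ℝ) :
    MemLp (fun t => Real.exp (l * t) • f t) p (volume.restrict (Ioc 0 T)) := by
  have hexp : Continuous fun t => Real.exp (l * t) := by fun_prop
  refine hf.of_le_mul (c := Real.exp (|l| * T)) (hexp.aestronglyMeasurable.smul hf.1) ?_
  filter_upwards [ae_restrict_mem measurableSet_Ioc] with t ht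
  rw [norm_smul, Real.norm_eq_abs, Real.abs_exp]
  gcongr
  · exact ht.1.le
  · exact le_abs_self l
  · exact ht.2

lemma LocallyAdmissible.exp_smul {u : ℝ → ℝ × State sbar} (hu : LocallyAdmissible u) (l : ℝ) :
    LocallyAdmissible fun t => Real.exp (l * t) • u t where
  fst T := memLp_exp_smul (hu.fst T) l
  snd T := memLp_one_iff_integrable.1
    (memLp_exp_smul (memLp_one_iff_integrable.2 (hu.snd T)) l)

/-- The profile on `(-T, 0)` which transport to the right with unit speed turns into the boundary
datum `u₀` during the times `(0, T)`. -/
def boundaryProfile (u₀ : ℝ → ℝ) (T : ℝ) : ℝ → ℝ := fun r => (Ioc 0 T).indicator u₀ (-r)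

lemma memLp_boundaryProfile {u₀ : ℝ → ℝ} {T : ℝ} (h : MemLp u₀ 2 (volume.restrict (Ioc 0 T))) :
    MemLp (boundaryProfile u₀ T) 2 volume :=
  ((memLp_indicator_iff_restrict measurableSet_Ioc).2 h).comp_measurePreserving
    (Measure.measurePreserving_neg volume)

lemma restrictAge_translate_boundaryProfile_coeFn (t : ℝ) {u₀ : ℝ → ℝ} {T : ℝ}
    (h : MemLp u₀ 2 (volume.restrict (Ioc 0 T))) :
    restrictAge sbar (translate t (memLp_boundaryProfile h).toLp) =ᵐ[ageMeasure sbar]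
      fun s => (Ioc 0 T).indicator u₀ (t - s) := by
  filter_upwards [restrictAge_coeFn (translate t (memLp_boundaryProfile h).toLp),
    ae_restrict_of_ae (translate_coeFn t (memLp_boundaryProfile h).toLp),
    ae_restrict_of_ae (ae_comp_sub_right (memLp_boundaryProfile h).coeFn_toLp t)] with s h1 h2 h3
  rw [h1, h2, h3, boundaryProfile, neg_sub]

lemma restrictAge_translate_boundaryProfile_of_le {u₀ : ℝ → ℝ} {t T : ℝ} (htT : t ≤ T)
    (ht : MemLp u₀ 2 (volume.restrict (Ioc 0 t))) (hT : MemLp u₀ 2 (volume.restrict (Ioc 0 T))) :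
    restrictAge sbar (translate t (memLp_boundaryProfile ht).toLp) =
      restrictAge sbar (translate t (memLp_boundaryProfile hT).toLp) := by
  refine Lp.ext ?_
  filter_upwards [restrictAge_translate_boundaryProfile_coeFn t ht,
    restrictAge_translate_boundaryProfile_coeFn t hT, ae_mem_ageSet sbar] with s h1 h2 hs
  have hst : t - s < t := sub_lt_self t hs.1
  rw [h1, h2]
  exact indicator_eq_indicator (by simp only [mem_Ioc, hst.le, (hst.le.trans htT)]) rfl

/-- The solution of `∂ₜ z + ∂ₛ z = u₁`, `z(t, 0) = u₀(t)`, `z(0, ·) = x`. All data are transported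
back along the characteristics to time `0`, where they form a profile on the whole line. -/
def transportSolution (x : State sbar) {u : ℝ → ℝ × State sbar} (hu : LocallyAdmissible u)
    (t : ℝ) : State sbar :=
  restrictAge sbar (translate t (extend sbar x + (memLp_boundaryProfile (hu.fst t)).toLp +
    ∫ τ in (0 : ℝ)..t, translate (-τ) (extend sbar (u τ).2)))

/-- The mild solution, obtained from the case `mu = 0` by damping. -/
def mildSolution (mu : ℝ) (x : State sbar) {u : ℝ → ℝ × State sbar} (hu : LocallyAdmissible u)
    (t : ℝ) : State sbar :=
  Real.exp (-mu * t) • transportSolution x (hu.exp_smul mu) t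

variable {u : ℝ → ℝ × State sbar}

lemma intervalIntegrable_translate_extend (hu : LocallyAdmissible u) {T : ℝ} (hT : 0 ≤ T) :
    IntervalIntegrable (fun τ => translate (-τ) (extend sbar (u τ).2)) volume 0 T := by
  have hcont : Continuous fun p : ℝ × State sbar => translate (-p.1) (extend sbar p.2) :=
    continuous_translate.comp
      (continuous_fst.neg.prodMk ((extend sbar).continuous.comp continuous_snd))
  have hmeas : AEStronglyMeasurable (fun τ => translate (-τ) (extend sbar (u τ).2))
      (volume.restrict (Ioc 0 T)) :=
    Continuous.comp_aestronglyMeasurable (f := fun τ => (τ, (u τ).2)) hcont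
      (aestronglyMeasurable_id.prodMk (hu.snd T).aestronglyMeasurable)
  rw [intervalIntegrable_iff_integrableOn_Ioc_of_le hT]
  refine (hu.snd T).norm.mono' hmeas (.of_forall fun τ => ?_)
  rw [(translate (-τ)).norm_map]
  exact ((extend sbar).le_of_opNorm_le norm_extend_le _).trans_eq (one_mul _)

lemma continuousOn_transportSolution (x : State sbar) (hu : LocallyAdmissible u) :
    ContinuousOn (transportSolution x hu) (Ici 0) := by
  have hcont : Continuous fun p : ℝ × Lp ℝ 2 (volume : Measure ℝ) =>
      restrictAge sbar (translate p.1 p.2) :=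
    (restrictAge sbar).continuous.comp continuous_translate
  have hIcc : ∀ T, 0 ≤ T → ContinuousOn (transportSolution x hu) (Icc 0 T) := by
    intro T hT
    have hprim := intervalIntegral.continuousOn_primitive_interval'
      (intervalIntegrable_translate_extend hu hT) left_mem_uIcc
    rw [uIcc_of_le hT] at hprim
    refine (hcont.comp_continuousOn (continuousOn_id.prodMk ((continuousOn_const
      (c := extend sbar x + (memLp_boundaryProfile (hu.fst T)).toLp)).add hprim))).congr
        fun t ht => ?_
    simp only [transportSolution, map_add, id_eq, Function.comp_apply, Pi.add_apply,
      restrictAge_translate_boundaryProfile_of_le ht.2 (hu.fst t) (hu.fst T)]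
  intro t ht
  refine (hIcc (t + 1) (add_nonneg ht zero_le_one) t ⟨ht, by linarith⟩).mono_of_mem_nhdsWithin ?_
  rw [← Ici_inter_Iic]
  exact inter_mem_nhdsWithin _ (Iic_mem_nhds (by linarith))

lemma inner_boundaryProfile {u₀ : ℝ → ℝ} {t : ℝ} (ht : 0 ≤ t)
    (h : MemLp u₀ 2 (volume.restrict (Ioc 0 t))) (f : Lp ℝ 2 (volume : Measure ℝ)) :
    IntervalIntegrable (fun τ => u₀ τ * f (t - τ)) volume 0 t ∧
      inner ℝ (memLp_boundaryProfile h).toLp (translate (-t) f) =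
        ∫ τ in (0 : ℝ)..t, u₀ τ * f (t - τ) := by
  set b := (memLp_boundaryProfile h).toLp
  have hcoe : ∀ᵐ r : ℝ, inner ℝ (b r) (translate (-t) f r) =
      inner ℝ ((Ioc 0 t).indicator u₀ (-r)) (f (r - -t)) := by
    filter_upwards [(memLp_boundaryProfile h).coeFn_toLp, translate_coeFn (-t) f] with r hb hf
    rw [hb, hf, boundaryProfile]
  have hneg : (fun τ => inner ℝ (b (-τ)) (translate (-t) f (-τ))) =ᵐ[volume]
      (Ioc 0 t).indicator fun τ => u₀ τ * f (t - τ) := by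
    filter_upwards
      [(Measure.measurePreserving_neg (volume : Measure ℝ)).quasiMeasurePreserving.ae hcoe]
      with τ hτ
    rw [hτ, neg_neg, sub_neg_eq_add, neg_add_eq_sub]
    by_cases hmem : τ ∈ Ioc 0 t
    · simp only [indicator_of_mem hmem, RCLike.inner_apply, conj_trivial, mul_comm]
    · rw [indicator_of_notMem hmem, indicator_of_notMem hmem, inner_zero_left]
  constructor
  · rw [intervalIntegrable_iff_integrableOn_Ioc_of_le ht,
      ← integrable_indicator_iff measurableSet_Ioc]
    exact (L2.integrable_inner (𝕜 := ℝ) b (translate (-t) f)).comp_neg.congr hneg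
  · rw [L2.inner_def, ← integral_neg_eq_self, integral_congr_ae hneg,
      integral_indicator measurableSet_Ioc, intervalIntegral.integral_of_le ht]

lemma inner_translate_translate_extend (t τ : ℝ) (x y : State sbar) :
    inner ℝ (translate (-τ) (extend sbar x)) (translate (-t) (extend sbar y)) =
      inner ℝ x (ageShift sbar (-(t - τ)) y) := by
  rw [inner_translate, translate_translate, ageShift_apply, real_inner_comm (restrictAge sbar _),
    inner_restrictAge, real_inner_comm, neg_neg, neg_sub, sub_eq_add_neg]

lemma inner_duhamel (hu : LocallyAdmissible u) {t : ℝ} (ht : 0 ≤ t) (y : State sbar) :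
    IntervalIntegrable (fun τ => inner ℝ (u τ).2 (ageShift sbar (-(t - τ)) y)) volume 0 t ∧
      inner ℝ (∫ τ in (0 : ℝ)..t, translate (-τ) (extend sbar (u τ).2))
          (translate (-t) (extend sbar y)) =
        ∫ τ in (0 : ℝ)..t, inner ℝ (u τ).2 (ageShift sbar (-(t - τ)) y) := by
  have hint := intervalIntegrable_translate_extend hu ht
  simp only [← inner_translate_translate_extend]
  refine ⟨?_, (((innerSL ℝ).flip (translate (-t) (extend sbar y))).intervalIntegral_comp_comm
    hint).symm⟩
  rw [intervalIntegrable_iff] at hint ⊢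
  exact hint.inner_const _

lemma inner_transportSolution (x : State sbar) (hu : LocallyAdmissible u) {t : ℝ} (ht : 0 ≤ t)
    (φ : State sbar) :
    inner ℝ (transportSolution x hu t) φ = inner ℝ x (observation φ t).2 +
      ∫ τ in (0 : ℝ)..t, pairing (u τ) (observation φ (t - τ)) := by
  obtain ⟨hboundary_int, hboundary⟩ := inner_boundaryProfile ht (hu.fst t) (extend sbar φ)
  obtain ⟨hduhamel_int, hduhamel⟩ := inner_duhamel hu ht φ
  have hinitial := inner_translate_translate_extend t 0 x φ
  rw [neg_zero, translate_zero, sub_zero] at hinitial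
  simp only [pairing_apply, observation]
  rw [intervalIntegral.integral_add hboundary_int hduhamel_int, transportSolution,
    inner_restrictAge, inner_translate, inner_add_left, inner_add_left, hinitial, hboundary,
    hduhamel, add_assoc]

lemma inner_mildSolution (mu : ℝ) (x : State sbar) (hu : LocallyAdmissible u) {t : ℝ} (ht : 0 ≤ t)
    (φ : State sbar) :
    inner ℝ (mildSolution mu x hu t) φ = mildFunctional mu x u φ t := by
  rw [mildSolution, real_inner_smul_left, inner_transportSolution x _ ht, mildFunctional,
    Prod.smul_snd, real_inner_smul_right, mul_add, ← intervalIntegral.integral_const_mul]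
  congr 1
  refine intervalIntegral.integral_congr fun τ _ => ?_
  simp only [map_smul, _root_.smul_apply, smul_eq_mul]
  rw [← mul_assoc, ← Real.exp_add]
  ring_nf

lemma isMildSolution_mildSolution (mu : ℝ) (x : State sbar) (hu : LocallyAdmissible u) :
    IsMildSolution sbar mu x u (mildSolution mu x hu) := by
  have hexp : Continuous fun t => Real.exp (-mu * t) := by fun_prop
  exact isMildSolution_iff.2
    ⟨hexp.continuousOn.smul (continuousOn_transportSolution x (hu.exp_smul mu)),
      fun t ht _ _ => inner_mildSolution mu x hu ht _⟩

lemma domAdjoint_of_contDiff {φ : ℝ → ℝ} (h : ContDiff ℝ (⊤ : ℕ∞) φ) (hc : HasCompactSupport φ)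
    (hs : tsupport φ ⊆ ageSet sbar) : DomAdjoint sbar φ := by
  have hderiv : Continuous (deriv φ) := h.continuous_deriv (by simp)
  refine ⟨⟨deriv φ, h.continuous.memLp_of_hasCompactSupport hc,
    hderiv.memLp_of_hasCompactSupport hc.deriv, fun s _ _ => ?_⟩, fun L hL => ?_⟩
  · rw [intervalIntegral.integral_deriv_eq_sub
      (fun x _ => (h.differentiable (by simp)) x) (hderiv.intervalIntegrable _ _),
      add_sub_cancel]
  · by_contra hne
    exact (hs (subset_tsupport φ hne)).2.ne hL

lemma eq_of_forall_domAdjoint {y z : State sbar}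
    (h : ∀ φ, ∀ hφ : DomAdjoint sbar φ,
      inner ℝ y hφ.memLp.toLp = inner ℝ z hφ.memLp.toLp) : y = z := by
  rw [← sub_eq_zero, Lp.eq_zero_iff_ae_eq_zero]
  have hloc : LocallyIntegrableOn (y - z) (ageSet sbar) :=
    locallyIntegrableOn_of_locallyIntegrable_restrict
      ((Lp.memLp (y - z)).locallyIntegrable one_le_two)
  refine (ae_restrict_iff' (measurableSet_ageSet sbar)).2
    ((isOpen_ageSet sbar).ae_eq_zero_of_integral_contDiff_smul_eq_zero hloc fun φ hφ hc hs => ?_)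
  have hdom := domAdjoint_of_contDiff hφ hc hs
  have hsupp : Function.support (fun s => φ s • (y - z) s) ⊆ ageSet sbar :=
    (Function.support_smul_subset_left _ _).trans ((subset_tsupport φ).trans hs)
  rw [← setIntegral_eq_integral_of_forall_compl_eq_zero
    fun s hs' => Function.notMem_support.1 fun h' => hs' (hsupp h')]
  simp only [smul_eq_mul, mul_comm (φ _)]
  exact (integral_mul_eq_inner _ hdom.memLp.coeFn_toLp.symm).trans
    (by rw [inner_sub_left, h φ hdom, sub_self])

lemma IsMildSolution.eqOn {mu : ℝ} {x : State sbar} {y y' : ℝ → State sbar}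
    (h : IsMildSolution sbar mu x u y) (h' : IsMildSolution sbar mu x u y') :
    EqOn y' y (Ici 0) := fun t ht =>
  eq_of_forall_domAdjoint fun φ hφ =>
    ((isMildSolution_iff.1 h').2 t ht φ hφ).trans ((isMildSolution_iff.1 h).2 t ht φ hφ).symm

lemma IsMildSolution.inner_eq {mu : ℝ} {x : State sbar} {y : ℝ → State sbar}
    (h : IsMildSolution sbar mu x u y) (hu : LocallyAdmissible u) {t : ℝ} (ht : 0 ≤ t)
    (φ : State sbar) : inner ℝ (y t) φ = mildFunctional mu x u φ t := by
  rw [(isMildSolution_mildSolution mu x hu).eqOn h ht, inner_mildSolution mu x hu ht]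

end MildSolution

section DiscountedRevenue

variable {sbar : EReal} {ρ mu l : ℝ} {u : ℝ → ℝ × State sbar}

lemma integrable_exp_ageMeasure (h : sbar = ⊤ → 0 < l) :
    Integrable (fun s => Real.exp (-l * s)) (ageMeasure sbar) := by
  have hexp : Continuous fun s => Real.exp (-l * s) := by fun_prop
  rw [ageMeasure_eq]
  induction sbar with
  | bot => simp [ageSet]
  | top => exact (exp_neg_integrableOn_Ioi 0 (h rfl)).mono_set fun s hs => hs.1
  | coe L =>
    exact hexp.integrableOn_Icc.mono_set fun s (hs : s ∈ ageSet L) =>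
      ⟨hs.1.le, (EReal.coe_lt_coe_iff.1 hs.2).le⟩

lemma memLp_exp_ageMeasure (h : sbar = ⊤ → 0 < l) :
    MemLp (fun s => Real.exp (-l * s)) 2 (ageMeasure sbar) := by
  have hexp : Continuous fun s => Real.exp (-l * s) := by fun_prop
  refine (memLp_two_iff_integrable_sq hexp.aestronglyMeasurable).2 ?_
  refine (integrable_exp_ageMeasure (l := 2 * l) fun htop => by linarith [h htop]).congr ?_
  filter_upwards with s
  rw [← Real.exp_nat_mul]
  congr 1
  push_cast
  ring

lemma ageMeasure_top : ageMeasure ⊤ = volume.restrict (Ioi 0) := by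
  rw [ageMeasure_eq]
  congr 1
  ext s
  simp [ageSet, EReal.coe_lt_top]

lemma Admissible.memLp (hu : Admissible sbar ρ u) :
    MemLp (fun t => Real.exp (-(ρ / 2) * t) • u t) 2 (volume.restrict (Ioi 0)) := by
  have hexp : Continuous fun t => Real.exp (-(ρ / 2) * t) := by fun_prop
  have hmeas := hexp.aestronglyMeasurable.smul hu.1
  refine (memLp_two_iff_integrable_sq_norm hmeas).2 (hu.2.mono' (hmeas.norm.pow 2) ?_)
  filter_upwards with t
  have hnorm : ‖u t‖ ≤ |(u t).1| + ‖(u t).2‖ :=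
    max_le_add_of_nonneg (abs_nonneg _) (norm_nonneg _)
  have hsq : Real.exp (-(ρ / 2) * t) ^ 2 = Real.exp (-ρ * t) := by
    rw [← Real.exp_nat_mul]
    congr 1
    push_cast
    ring
  rw [norm_pow, norm_norm, Pi.smul_apply', norm_smul, Real.norm_of_nonneg (Real.exp_pos _).le,
    mul_pow, hsq]
  gcongr

lemma Admissible.locallyAdmissible (hu : Admissible sbar ρ u) : LocallyAdmissible u := by
  have hloc : ∀ T, MemLp u 2 (volume.restrict (Ioc 0 T)) := fun T => by
    have hmem : MemLp (fun t => Real.exp (-(ρ / 2) * t) • u t) 2 (volume.restrict (Ioc 0 T)) :=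
      hu.memLp.mono_measure (Measure.restrict_mono_set _ Ioc_subset_Ioi_self)
    refine (memLp_congr_ae (Eventually.of_forall fun t => ?_)).1 (memLp_exp_smul hmem (ρ / 2))
    simp only [smul_smul, ← Real.exp_add, neg_mul, add_neg_cancel, Real.exp_zero, one_smul]
  exact ⟨fun T => (hloc T).fst, fun T => (hloc T).snd.integrable one_le_two⟩

lemma Admissible.integrableOn_exp_smul (hρ : 0 < ρ) (hu : Admissible sbar ρ u) :
    IntegrableOn (fun t => Real.exp (-ρ * t) • u t) (Ioi 0) := by
  have hexp : MemLp (fun t => Real.exp (-(ρ / 2) * t)) 2 (volume.restrict (Ioi 0)) := by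
    simpa only [ageMeasure_top] using memLp_exp_ageMeasure (sbar := ⊤) fun _ => half_pos hρ
  have hprod := hu.memLp.smul hexp (r := 1)
  refine (memLp_one_iff_integrable.1 hprod).congr ?_
  filter_upwards with t
  rw [Pi.smul_apply', smul_smul, ← Real.exp_add]
  congr 2
  ring

lemma observation_ae_eq_zero (φ : State sbar) :
    ∀ᵐ r : ℝ, r ∈ Ioi 0 \ ageSet sbar → observation φ r = 0 := by
  filter_upwards [extend_coeFn φ] with r hr hmem
  rw [observation, hr, indicator_of_notMem hmem.2, ageShift_neg_eq_zero hmem.1 hmem.2,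
    Prod.mk_zero_zero]

lemma integrableOn_exp_smul_observation (hl : sbar = ⊤ → 0 < l) (φ : State sbar) :
    IntegrableOn (fun r => Real.exp (-l * r) • observation φ r) (Ioi 0) := by
  have hexp : Continuous fun r => Real.exp (-l * r) := by fun_prop
  have hage : IntegrableOn (fun r => Real.exp (-l * r) • observation φ r) (ageSet sbar) := by
    refine Integrable.prodMk
      ((memLp_exp_ageMeasure hl).integrable_mul ((Lp.memLp (extend sbar φ)).restrict _)) ?_
    refine ((integrable_exp_ageMeasure hl).mul_const ‖φ‖).mono' (hexp.smul
      ((continuous_ageShift φ).comp continuous_neg)).aestronglyMeasurable ?_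
    filter_upwards with r
    rw [norm_smul, Real.norm_of_nonneg (Real.exp_pos _).le]
    gcongr
    exact norm_ageShift_le (-r) φ
  refine hage.of_ae_sdiff_eq_zero measurableSet_Ioi.nullMeasurableSet ?_
  filter_upwards [observation_ae_eq_zero φ] with r hr hmem
  rw [hr hmem, smul_zero]

/-- The observation `B* (l - A₀*)⁻¹ φ`, where `A₀ = - d/ds` generates the undamped transport
semigroup: the resolvent is the Laplace transform of the semigroup. As `A = A₀ - mu`, the choice
`l = ρ + mu` gives `B* (ρ - A*)⁻¹ φ`. -/
def adjointResolvent (l : ℝ) (φ : State sbar) : ℝ × State sbar :=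
  ∫ r in Ioi 0, Real.exp (-l * r) • observation φ r

lemma exp_mul_mildFunctional (x : State sbar) (φ : State sbar) (t : ℝ) :
    Real.exp (-ρ * t) * mildFunctional mu x u φ t =
      inner ℝ x (Real.exp (-(ρ + mu) * t) • observation φ t).2 +
        ∫ τ in (0 : ℝ)..t, pairing (Real.exp (-ρ * τ) • u τ)
          (Real.exp (-(ρ + mu) * (t - τ)) • observation φ (t - τ)) := by
  have hexp : ∀ r, Real.exp (-(ρ + mu) * r) = Real.exp (-ρ * r) * Real.exp (-mu * r) :=
    fun r => by rw [← Real.exp_add]; congr 1; ring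
  rw [mildFunctional, mul_add, ← intervalIntegral.integral_const_mul]
  congr 1
  · simp only [hexp, mul_smul, Prod.smul_snd, real_inner_smul_right]
  · refine intervalIntegral.integral_congr fun τ _ => ?_
    have hsplit : Real.exp (-ρ * t) = Real.exp (-ρ * τ) * Real.exp (-ρ * (t - τ)) := by
      rw [← Real.exp_add]; congr 1; ring
    simp only [hexp, hsplit, mul_smul, map_smul, _root_.smul_apply, smul_eq_mul]
    ring

section Integral

variable (x : State sbar) (φ : State sbar)

lemma exp_mul_mildFunctional_eqOn : EqOn (fun t => Real.exp (-ρ * t) * mildFunctional mu x u φ t)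
    (fun t => inner ℝ x (Real.exp (-(ρ + mu) * t) • observation φ t).2 +
      posConvolution (fun τ => Real.exp (-ρ * τ) • u τ)
        (fun r => Real.exp (-(ρ + mu) * r) • observation φ r) pairing volume t) (Ioi 0) :=
  fun t ht => by
    simp only [exp_mul_mildFunctional, posConvolution, indicator_of_mem ht]

variable (hu : IntegrableOn (fun t => Real.exp (-ρ * t) • u t) (Ioi 0))
  (hmu : sbar = ⊤ → 0 < ρ + mu)

include hu hmu

lemma integrableOn_exp_mul_mildFunctional :
    IntegrableOn (fun t => Real.exp (-ρ * t) * mildFunctional mu x u φ t) (Ioi 0) := by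
  have hobs := integrableOn_exp_smul_observation hmu φ
  refine (Integrable.add (hobs.snd.const_inner x)
    (integrable_posConvolution hu hobs pairing).integrableOn).congr ?_
  filter_upwards [ae_restrict_mem measurableSet_Ioi] with t ht
  exact (exp_mul_mildFunctional_eqOn x φ ht).symm

lemma integral_exp_mul_mildFunctional :
    ∫ t in Ioi 0, Real.exp (-ρ * t) * mildFunctional mu x u φ t =
      inner ℝ x (adjointResolvent (ρ + mu) φ).2 +
        pairing (∫ t in Ioi 0, Real.exp (-ρ * t) • u t) (adjointResolvent (ρ + mu) φ) := by
  have hobs := integrableOn_exp_smul_observation hmu φ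
  have hconv := integral_posConvolution hu hobs pairing
  rw [setIntegral_congr_fun measurableSet_Ioi (exp_mul_mildFunctional_eqOn x φ),
    integral_add (hobs.snd.const_inner x)
      (integrable_posConvolution hu hobs pairing).integrableOn,
    integral_inner hobs.snd, ← snd_integral hobs]
  congr 1
  rw [adjointResolvent, ← hconv]
  exact setIntegral_congr_fun measurableSet_Ioi fun t ht => indicator_of_mem ht _

end Integral

lemma aestronglyMeasurable_indicator_comp {f : ℝ → ℝ}
    (hf : AEStronglyMeasurable f (ageMeasure sbar)) {q : ℝ × ℝ → ℝ}
    (hq : Measure.QuasiMeasurePreserving q (volume.prod volume) volume) (S T : Set ℝ) :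
    AEStronglyMeasurable (fun p => (ageSet sbar).indicator f (q p))
      ((volume.restrict S).prod (volume.restrict T)) :=
  have hind := (aestronglyMeasurable_indicator_iff (measurableSet_ageSet sbar)).2 hf
  (hind.comp_quasiMeasurePreserving hq).mono_measure
    (Measure.prod_mono Measure.restrict_le_self Measure.restrict_le_self)

variable {f : ℝ → ℝ}

lemma adjointResolvent_fst (hl : sbar = ⊤ → 0 < l) (hf : MemLp f 2 (ageMeasure sbar)) :
    (adjointResolvent l hf.toLp).1 = ∫ σ in ageSet sbar, Real.exp (-l * σ) * f σ := by
  have hsub : ageSet sbar ⊆ Ioi 0 := fun σ hσ => hσ.1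
  rw [adjointResolvent, fst_integral (integrableOn_exp_smul_observation hl _),
    ← inter_eq_self_of_subset_right hsub, ← setIntegral_indicator (measurableSet_ageSet sbar)]
  refine setIntegral_congr_ae measurableSet_Ioi ?_
  filter_upwards [(memLp_indicator_ageSet hf).coeFn_toLp] with σ hσ _
  rw [Prod.smul_fst, observation, extend_eq_toLp, hσ]
  exact (indicator_mul_right _ (fun σ => Real.exp (-l * σ)) f).symm

lemma setIntegral_Ioi_indicator_comp_add {s : ℝ} (hs : 0 < s) (f : ℝ → ℝ) :
    ∫ r in Ioi 0, Real.exp (-l * r) * (ageSet sbar).indicator f (r + s) =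
      ∫ σ in {σ : ℝ | s < σ ∧ (σ : EReal) < sbar}, Real.exp (-l * (σ - s)) * f σ := by
  have hS : {σ : ℝ | s < σ ∧ (σ : EReal) < sbar} = Ioi s ∩ ageSet sbar := by
    ext σ
    exact ⟨fun h => ⟨h.1, hs.trans h.1, h.2⟩, fun h => ⟨h.1, h.2.2⟩⟩
  rw [hS, ← setIntegral_indicator (measurableSet_ageSet sbar),
    ← integral_indicator measurableSet_Ioi, ← integral_indicator measurableSet_Ioi,
    ← integral_add_right_eq_self ((Ioi s).indicator _) s]
  refine integral_congr_ae (Eventually.of_forall fun r => ?_)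
  by_cases hr : 0 < r <;> by_cases hrs : r + s ∈ ageSet sbar <;>
    simp [hr, hrs]

lemma adjointResolvent_snd_coeFn (hl : sbar = ⊤ → 0 < l) (hf : MemLp f 2 (ageMeasure sbar)) :
    (adjointResolvent l hf.toLp).2 =ᵐ[ageMeasure sbar]
      fun s => ∫ σ in {σ : ℝ | s < σ ∧ (σ : EReal) < sbar}, Real.exp (-l * (σ - s)) * f σ := by
  have hobs := integrableOn_exp_smul_observation hl hf.toLp
  have hexp : Continuous fun p : ℝ × ℝ => Real.exp (-l * p.1) := by fun_prop
  rw [adjointResolvent, snd_integral hobs]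
  refine (coeFn_integral_Lp (g := fun r s => Real.exp (-l * r) * (ageSet sbar).indicator f (r + s))
    hobs.snd (hexp.aestronglyMeasurable.mul (aestronglyMeasurable_indicator_comp hf.1
      (quasiMeasurePreserving_add volume volume) _ _)) (Eventually.of_forall fun r => ?_)).trans ?_
  · filter_upwards [Lp.coeFn_smul (Real.exp (-l * r)) (ageShift sbar (-r) hf.toLp),
      ageShift_toLp_coeFn (-r) hf] with s hsmul hshift
    rw [Prod.smul_snd, observation, hsmul, Pi.smul_apply, hshift, sub_neg_eq_add, smul_eq_mul,
      add_comm s]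
  · filter_upwards [ae_mem_ageSet sbar] with s hs
    exact setIntegral_Ioi_indicator_comp_add hs.1 f

end DiscountedRevenue

section Admissible

variable {sbar : EReal} {ρ : ℝ}

lemma admissible_const (hρ : 0 < ρ) (w : ℝ × State sbar) : Admissible sbar ρ fun _ => w :=
  ⟨aestronglyMeasurable_const, (exp_neg_integrableOn_Ioi 0 hρ).mul_const _⟩

lemma Admissible.integrableOn_exp_mul_apply {u v : ℝ → ℝ × State sbar} (hu : Admissible sbar ρ u)
    (hv : Admissible sbar ρ v) (B : (ℝ × State sbar) →L[ℝ] (ℝ × State sbar) →L[ℝ] ℝ) :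
    IntegrableOn (fun t => Real.exp (-ρ * t) * B (u t) (v t)) (Ioi 0) := by
  refine (memLp_one_iff_integrable.1 (B.memLp_of_bilin 1 hu.memLp hv.memLp)).congr ?_
  filter_upwards with t
  simp only [map_smul, _root_.smul_apply, smul_eq_mul, ← mul_assoc, ← Real.exp_add]
  ring_nf

end Admissible

/-- The regularity under which the control problem is solved: `α` and `q₁` are square integrable,
and the quadratic cost coefficients are bounded and bounded away from `0`. -/
structure RegularCoeffs (sbar : EReal) (c : Coeffs) : Prop where
  alpha_memLp : MemLp c.α 2 (ageMeasure sbar)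
  q1_memLp : MemLp c.q1 2 (ageMeasure sbar)
  beta1_memLp : MemLp c.β1 ⊤ (ageMeasure sbar)
  beta1_bound : ∃ ε : ℝ, 0 < ε ∧ ∀ᵐ s ∂ageMeasure sbar, ε ≤ c.β1 s
  beta0_pos : 0 < c.β0

namespace RegularCoeffs

variable {sbar : EReal} {mu : ℝ} {c : Coeffs}

lemma ae_beta1_pos (hc : RegularCoeffs sbar c) : ∀ᵐ s ∂ageMeasure sbar, 0 < c.β1 s := by
  obtain ⟨ε, hε, hle⟩ := hc.beta1_bound
  exact hle.mono fun s hs => hε.trans_le hs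

/-- The bilinear form `Q(v, w) = β₀ v₀ w₀ + ∫ β₁ v₁ w₁` whose diagonal is the quadratic part of
the investment costs. -/
def costForm (hc : RegularCoeffs sbar c) :
    (ℝ × State sbar) →L[ℝ] (ℝ × State sbar) →L[ℝ] ℝ :=
  pairing ∘L (c.β0 • ContinuousLinearMap.id ℝ ℝ).prodMap
    ((ContinuousLinearMap.mul ℝ ℝ).holderL (ageMeasure sbar) ⊤ 2 2 hc.beta1_memLp.toLp)

variable (hc : RegularCoeffs sbar c)

include hc

lemma integrable_beta1_mul_mul (f g : State sbar) :
    Integrable (fun s => f s * (c.β1 s * g s)) (ageMeasure sbar) :=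
  (Lp.memLp f).integrable_mul
    ((ContinuousLinearMap.mul ℝ ℝ).memLp_of_bilin 2 hc.beta1_memLp (Lp.memLp g))

lemma costForm_apply (v w : ℝ × State sbar) :
    hc.costForm v w =
      c.β0 * v.1 * w.1 + ∫ s, w.2 s * (c.β1 s * v.2 s) ∂ageMeasure sbar := by
  have hmul : (fun s => c.β1 s * v.2 s) =ᵐ[ageMeasure sbar]
      (ContinuousLinearMap.mul ℝ ℝ).holder 2 hc.beta1_memLp.toLp v.2 := by
    filter_upwards [hc.beta1_memLp.coeFn_toLp, (ContinuousLinearMap.mul ℝ ℝ).coeFn_holder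
      (r := 2) hc.beta1_memLp.toLp v.2] with s hβ hholder
    rw [hholder, hβ, ContinuousLinearMap.mul_apply']
  rw [integral_mul_eq_inner w.2 hmul, real_inner_comm]
  rfl

lemma costForm_comm (v w : ℝ × State sbar) : hc.costForm v w = hc.costForm w v := by
  rw [costForm_apply, costForm_apply, mul_right_comm]
  congr 2
  ext s
  ring

lemma costForm_self_nonneg (v : ℝ × State sbar) : 0 ≤ hc.costForm v v := by
  rw [costForm_apply, mul_assoc]
  refine add_nonneg (mul_nonneg hc.beta0_pos.le (mul_self_nonneg _)) (integral_nonneg_of_ae ?_)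
  filter_upwards [hc.ae_beta1_pos] with s hs
  rw [mul_left_comm]
  exact mul_nonneg hs.le (mul_self_nonneg _)

lemma costForm_self_eq_zero_iff {v : ℝ × State sbar} : hc.costForm v v = 0 ↔ v = 0 := by
  refine ⟨fun h => ?_, fun h => by rw [h, map_zero]⟩
  have hnonneg : 0 ≤ᵐ[ageMeasure sbar] fun s => v.2 s * (c.β1 s * v.2 s) := by
    filter_upwards [hc.ae_beta1_pos] with s hs
    rw [mul_left_comm]
    exact mul_nonneg hs.le (mul_self_nonneg _)
  rw [costForm_apply, mul_assoc, add_eq_zero_iff_of_nonneg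
    (mul_nonneg hc.beta0_pos.le (mul_self_nonneg _)) (integral_nonneg_of_ae hnonneg),
    integral_eq_zero_iff_of_nonneg_ae hnonneg (hc.integrable_beta1_mul_mul v.2 v.2)] at h
  refine Prod.ext (mul_self_eq_zero.1 ((mul_eq_zero.1 h.1).resolve_left hc.beta0_pos.ne')) ?_
  refine (Lp.eq_zero_iff_ae_eq_zero (f := v.2)).2 ?_
  filter_upwards [h.2, hc.ae_beta1_pos] with s hs hβ
  simpa [hβ.ne'] using hs

/-- The linear part `(q₀, q₁)` of the investment costs. -/
def unitCost : ℝ × State sbar := (c.q0, hc.q1_memLp.toLp)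

lemma integrable_profitDensity (x w : State sbar) :
    Integrable (profitDensity c x w) (ageMeasure sbar) := by
  refine ((hc.alpha_memLp.integrable_mul (Lp.memLp x)).sub
    (hc.q1_memLp.integrable_mul (Lp.memLp w))).sub ?_
  refine (hc.integrable_beta1_mul_mul w w).congr (Eventually.of_forall fun s => ?_)
  simp only
  ring

lemma profitRate_eq (x : State sbar) (u : ℝ × State sbar) :
    profitRate c x u =
      inner ℝ x hc.alpha_memLp.toLp - pairing u hc.unitCost - hc.costForm u u := by
  have hα := (Lp.memLp x).integrable_mul hc.alpha_memLp
  have hq := (Lp.memLp u.2).integrable_mul hc.q1_memLp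
  have hβ := hc.integrable_beta1_mul_mul u.2 u.2
  have hdensity : profitDensity c x u.2 =
      ⇑x * c.α - ⇑u.2 * c.q1 - fun s => u.2 s * (c.β1 s * u.2 s) := by
    ext s
    simp only [profitDensity, Pi.sub_apply, Pi.mul_apply]
    ring
  have hint : ∫ s, profitDensity c x u.2 s ∂ageMeasure sbar =
      inner ℝ x hc.alpha_memLp.toLp - inner ℝ u.2 hc.q1_memLp.toLp -
        ∫ s, u.2 s * (c.β1 s * u.2 s) ∂ageMeasure sbar := by
    rw [hdensity, integral_sub' (hα.sub hq) hβ, integral_sub' hα hq,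
      ← integral_mul_eq_inner x hc.alpha_memLp.coeFn_toLp.symm,
      ← integral_mul_eq_inner u.2 hc.q1_memLp.coeFn_toLp.symm]
    rfl
  rw [profitRate, hint, pairing_apply, costForm_apply, unitCost]
  ring

/-- The shadow price `B* (ρ - A*)⁻¹ α = (ᾱ(0), ᾱ)` of investment: the present value of the
revenue that one unit of new, respectively used, capital generates during its lifetime. -/
def shadowPrice (mu : ℝ) : ℝ × State sbar := adjointResolvent (c.ρ + mu) hc.alpha_memLp.toLp

variable (hmu : sbar = ⊤ → 0 < c.ρ + mu)

include hmu

lemma shadowPrice_fst : (hc.shadowPrice mu).1 = alphaBar sbar mu c 0 := by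
  rw [shadowPrice, adjointResolvent_fst hmu, alphaBar]
  simp only [sub_zero]
  rfl

lemma shadowPrice_snd_coeFn : (hc.shadowPrice mu).2 =ᵐ[ageMeasure sbar] alphaBar sbar mu c :=
  adjointResolvent_snd_coeFn hmu hc.alpha_memLp

lemma memLp_optDistributed : MemLp (optDistributed sbar mu c) 2 (ageMeasure sbar) := by
  obtain ⟨ε, hε, hle⟩ := hc.beta1_bound
  have hnum : MemLp (alphaBar sbar mu c - c.q1) 2 (ageMeasure sbar) :=
    ((memLp_congr_ae (hc.shadowPrice_snd_coeFn hmu)).1 (Lp.memLp _)).sub hc.q1_memLp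
  refine hnum.of_le_mul (c := (2 * ε)⁻¹)
    (hnum.1.aemeasurable.div (hc.beta1_memLp.1.aemeasurable.const_mul 2)).aestronglyMeasurable ?_
  filter_upwards [hle] with s hs
  rw [optDistributed, norm_div, div_eq_inv_mul, Pi.sub_apply,
    Real.norm_of_nonneg (by linarith : 0 ≤ 2 * c.β1 s)]
  gcongr

/-- The control `u* = (u₀*, u₁*)`; by `two_mul_costForm_optControl`, it is the stationary point of
the concave function `w ↦ ⟨w, k - q⟩ - Q(w, w)`, where `k` is the shadow price. -/
def optControl : ℝ × State sbar := (optBoundary sbar mu c, (hc.memLp_optDistributed hmu).toLp)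

lemma two_mul_costForm_optControl (v : ℝ × State sbar) :
    2 * hc.costForm v (hc.optControl hmu) = pairing v (hc.shadowPrice mu - hc.unitCost) := by
  have hfst : 2 * (c.β0 * optBoundary sbar mu c) = alphaBar sbar mu c 0 - c.q0 := by
    have := hc.beta0_pos.ne'
    rw [optBoundary]
    field_simp
  have hsnd : (fun s => 2 * (c.β1 s * (hc.optControl hmu).2 s)) =ᵐ[ageMeasure sbar]
      ((hc.shadowPrice mu - hc.unitCost).2 : State sbar) := by
    filter_upwards [Lp.coeFn_sub (hc.shadowPrice mu).2 hc.unitCost.2,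
      (hc.memLp_optDistributed hmu).coeFn_toLp, hc.shadowPrice_snd_coeFn hmu,
      hc.q1_memLp.coeFn_toLp, hc.ae_beta1_pos] with s hsub hopt hprice hq hβ
    rw [optControl, hopt, Prod.snd_sub, hsub, Pi.sub_apply, hprice, unitCost, hq, optDistributed]
    field_simp
  rw [costForm_comm, costForm_apply, pairing_apply, ← integral_mul_eq_inner v.2 hsnd, Prod.fst_sub,
    hc.shadowPrice_fst hmu, unitCost, ← hfst, mul_add, ← integral_const_mul, optControl]
  congr 1
  · ring
  · congr 1
    ext s
    ring

lemma costForm_sub_optControl (v : ℝ × State sbar) :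
    hc.costForm (v - hc.optControl hmu) (v - hc.optControl hmu) =
      hc.costForm v v - pairing v (hc.shadowPrice mu - hc.unitCost) +
        hc.costForm (hc.optControl hmu) (hc.optControl hmu) := by
  rw [← hc.two_mul_costForm_optControl hmu]
  simp only [map_sub, _root_.sub_apply, hc.costForm_comm (hc.optControl hmu) v]
  ring

lemma profitRate_eq_sub_costForm (x : State sbar) (v : ℝ × State sbar) :
    profitRate c x v = inner ℝ x hc.alpha_memLp.toLp - pairing v (hc.shadowPrice mu) +
      hc.costForm (hc.optControl hmu) (hc.optControl hmu) -
        hc.costForm (v - hc.optControl hmu) (v - hc.optControl hmu) := by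
  rw [hc.profitRate_eq, hc.costForm_sub_optControl hmu, map_sub]
  ring

lemma explicitValue_eq (hρ : 0 < c.ρ) (x : State sbar) :
    explicitValue sbar mu c x = inner ℝ x (hc.shadowPrice mu).2 +
      hc.costForm (hc.optControl hmu) (hc.optControl hmu) / c.ρ := by
  have hβ := hc.beta0_pos.ne'
  have hlin : ∫ s, alphaBar sbar mu c s * x s ∂ageMeasure sbar =
      inner ℝ x (hc.shadowPrice mu).2 := by
    simp only [mul_comm (alphaBar sbar mu c _)]
    exact integral_mul_eq_inner x (hc.shadowPrice_snd_coeFn hmu).symm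
  have hquad : ∫ s, (alphaBar sbar mu c s - c.q1 s) ^ 2 / (4 * c.ρ * c.β1 s) ∂ageMeasure sbar =
      (∫ s, (hc.optControl hmu).2 s * (c.β1 s * (hc.optControl hmu).2 s) ∂ageMeasure sbar) /
        c.ρ := by
    rw [← integral_div]
    refine integral_congr_ae ?_
    filter_upwards [(hc.memLp_optDistributed hmu).coeFn_toLp, hc.ae_beta1_pos] with s hopt hβ1
    rw [optControl, hopt, optDistributed]
    field_simp
    norm_num
  rw [explicitValue, hlin, hquad, costForm_apply, add_div, ← add_assoc, optControl, optBoundary]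
  congr 2
  field_simp
  norm_num

/-- The discounted cost of the deviation of a control from `u*`. -/
def discountedLoss (u : ℝ → ℝ × State sbar) : ℝ :=
  ∫ t in Ioi 0, Real.exp (-c.ρ * t) *
    hc.costForm (u t - hc.optControl hmu) (u t - hc.optControl hmu)

lemma discountedLoss_nonneg (u : ℝ → ℝ × State sbar) : 0 ≤ hc.discountedLoss hmu u :=
  integral_nonneg fun _ => mul_nonneg (Real.exp_pos _).le (hc.costForm_self_nonneg _)

section Control

variable {x : State sbar} {u : ℝ → ℝ × State sbar} {y : ℝ → State sbar} (hρ : 0 < c.ρ)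
  (hu : Admissible sbar c.ρ u)

include hρ hu

lemma integrableOn_loss : IntegrableOn (fun t => Real.exp (-c.ρ * t) *
    hc.costForm (u t - hc.optControl hmu) (u t - hc.optControl hmu)) (Ioi 0) := by
  simp only [hc.costForm_sub_optControl hmu, mul_add, mul_sub]
  exact ((hu.integrableOn_exp_mul_apply hu hc.costForm).sub
    (hu.integrableOn_exp_mul_apply (admissible_const hρ _) pairing)).add
    ((exp_neg_integrableOn_Ioi 0 hρ).mul_const _)

lemma discountedLoss_eq_zero_iff : hc.discountedLoss hmu u = 0 ↔
    ∀ᵐ t ∂volume.restrict (Ioi (0 : ℝ)), u t = hc.optControl hmu := by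
  rw [discountedLoss, integral_eq_zero_iff_of_nonneg
    (fun _ => mul_nonneg (Real.exp_pos _).le (hc.costForm_self_nonneg _))
    (hc.integrableOn_loss hmu hρ hu)]
  refine eventually_congr (Eventually.of_forall fun t => ?_)
  rw [Pi.zero_apply, mul_eq_zero, costForm_self_eq_zero_iff, sub_eq_zero,
    or_iff_right (Real.exp_pos _).ne']

lemma integrableOn_exp_mul_inner_sub_pairing (hy : IsMildSolution sbar mu x u y) :
    IntegrableOn (fun t => Real.exp (-c.ρ * t) *
      (inner ℝ (y t) hc.alpha_memLp.toLp - pairing (u t) (hc.shadowPrice mu))) (Ioi 0) := by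
  refine ((integrableOn_exp_mul_mildFunctional x hc.alpha_memLp.toLp
    (hu.integrableOn_exp_smul hρ) hmu).sub (hu.integrableOn_exp_mul_apply
      (admissible_const hρ (hc.shadowPrice mu)) pairing)).congr_fun (fun t ht => ?_)
    measurableSet_Ioi
  rw [Pi.sub_apply, ← mul_sub, hy.inner_eq hu.locallyAdmissible (le_of_lt ht)]

/-- The discounted revenue is the value of the initial capital plus that of all investments, both
at shadow prices. -/
lemma integral_exp_mul_inner_sub_pairing (hy : IsMildSolution sbar mu x u y) :
    ∫ t in Ioi 0, Real.exp (-c.ρ * t) *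
      (inner ℝ (y t) hc.alpha_memLp.toLp - pairing (u t) (hc.shadowPrice mu)) =
        inner ℝ x (hc.shadowPrice mu).2 := by
  have hdisc := hu.integrableOn_exp_smul hρ
  have hprice : ∫ t in Ioi 0, Real.exp (-c.ρ * t) * pairing (u t) (hc.shadowPrice mu) =
      pairing (∫ t in Ioi 0, Real.exp (-c.ρ * t) • u t) (hc.shadowPrice mu) := by
    simpa only [ContinuousLinearMap.flip_apply, map_smul, smul_eq_mul] using
      (pairing.flip (hc.shadowPrice mu)).integral_comp_comm hdisc
  have hsplit : EqOn (fun t => Real.exp (-c.ρ * t) *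
      (inner ℝ (y t) hc.alpha_memLp.toLp - pairing (u t) (hc.shadowPrice mu)))
      (fun t => Real.exp (-c.ρ * t) * mildFunctional mu x u hc.alpha_memLp.toLp t -
        Real.exp (-c.ρ * t) * pairing (u t) (hc.shadowPrice mu)) (Ioi 0) := fun t ht => by
    simp only [← mul_sub, hy.inner_eq hu.locallyAdmissible (le_of_lt ht)]
  rw [setIntegral_congr_fun measurableSet_Ioi hsplit,
    integral_sub (integrableOn_exp_mul_mildFunctional x _ hdisc hmu)
      (hu.integrableOn_exp_mul_apply (admissible_const hρ _) pairing),
    integral_exp_mul_mildFunctional x _ hdisc hmu, hprice]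
  exact add_sub_cancel_right _ _

lemma payoffFinite_and_payoff_eq (hy : IsMildSolution sbar mu x u y) :
    PayoffFinite c y u ∧
      payoff c y u = explicitValue sbar mu c x - hc.discountedLoss hmu u := by
  have hrevenue := hc.integrableOn_exp_mul_inner_sub_pairing hmu hρ hu hy
  have hconst := (exp_neg_integrableOn_Ioi 0 hρ).mul_const
    (hc.costForm (hc.optControl hmu) (hc.optControl hmu))
  have hloss := hc.integrableOn_loss hmu hρ hu
  have hexp : ∫ t in Ioi (0 : ℝ), Real.exp (-c.ρ * t) = 1 / c.ρ := by
    rw [integral_exp_mul_Ioi (neg_lt_zero.2 hρ), mul_zero, Real.exp_zero, neg_div_neg_eq]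
  have hgain := Integrable.fun_add hrevenue hconst
  have hprofit := funext fun t => congrArg (Real.exp (-c.ρ * t) * ·)
    (hc.profitRate_eq_sub_costForm hmu (y t) (u t))
  simp only [mul_add, mul_sub (_ : ℝ) (_ + _)] at hprofit
  refine ⟨⟨fun t _ => hc.integrable_profitDensity _ _, ?_⟩, ?_⟩
  · rw [hprofit]
    exact hgain.sub hloss
  · rw [payoff, hprofit, integral_sub hgain hloss, integral_add hrevenue hconst,
      hc.integral_exp_mul_inner_sub_pairing hmu hρ hu hy, integral_mul_const, hexp,
      hc.explicitValue_eq hmu hρ, discountedLoss, one_div_mul_eq_div]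

end Control

section Optimality

variable (hρ : 0 < c.ρ)

include hρ

lemma valueFunction_eq (x : State sbar) :
    valueFunction sbar mu c x = ((explicitValue sbar mu c x : ℝ) : EReal) := by
  refine IsGreatest.csSup_eq ⟨?_, ?_⟩
  · have hadm := admissible_const hρ (hc.optControl hmu)
    have hy := isMildSolution_mildSolution mu x hadm.locallyAdmissible
    have hloss : hc.discountedLoss hmu (fun _ => hc.optControl hmu) = 0 :=
      (hc.discountedLoss_eq_zero_iff hmu hρ hadm).2 (Eventually.of_forall fun _ => rfl)
    refine ⟨_, _, hadm, hy, ?_⟩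
    rw [(hc.payoffFinite_and_payoff_eq hmu hρ hadm hy).2, hloss, sub_zero]
  · rintro r ⟨u, y, hu, hy, rfl⟩
    rw [(hc.payoffFinite_and_payoff_eq hmu hρ hu hy).2, EReal.coe_le_coe_iff]
    exact sub_le_self _ (hc.discountedLoss_nonneg hmu u)

lemma isOptimal_iff {x : State sbar} {u : ℝ → ℝ × State sbar} (hu : Admissible sbar c.ρ u) :
    IsOptimal sbar mu c x u ↔
      ∀ᵐ t ∂volume.restrict (Ioi (0 : ℝ)), u t = hc.optControl hmu := by
  have hpayoff : ∀ y, IsMildSolution sbar mu x u y →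
      (((payoff c y u : ℝ) : EReal) = valueFunction sbar mu c x ↔
        hc.discountedLoss hmu u = 0) := fun y hy => by
    rw [hc.valueFunction_eq hmu hρ, EReal.coe_eq_coe_iff,
      (hc.payoffFinite_and_payoff_eq hmu hρ hu hy).2, sub_eq_self]
  rw [← hc.discountedLoss_eq_zero_iff hmu hρ hu]
  refine ⟨fun ⟨_, y, hy, h⟩ => (hpayoff y hy).1 h, fun h => ⟨hu, ?_⟩⟩
  have hy := isMildSolution_mildSolution mu x hu.locallyAdmissible
  exact ⟨_, hy, (hpayoff _ hy).2 h⟩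

end Optimality

end RegularCoeffs

section CoeffAssumption

variable {sbar : EReal}

lemma ageSet_coe (L : ℝ) : ageSet (L : EReal) = Ioo 0 L := by
  ext s
  simp [ageSet]

lemma antitoneOn_of_hasH1Deriv {f g : ℝ → ℝ}
    (h : ∀ L : ℝ, 0 < L → (L : EReal) ≤ sbar → HasH1Deriv (L : EReal) f g)
    (hg : ∀ᵐ s ∂ageMeasure sbar, g s ≤ 0) : AntitoneOn f {s : ℝ | 0 ≤ s ∧ (s : EReal) ≤ sbar} := by
  intro s hs t ht hst
  obtain rfl | hlt := hst.eq_or_lt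
  · exact le_rfl
  have ht0 : 0 < t := hs.1.trans_lt hlt
  obtain ⟨-, hgL2, hprimitive⟩ := h t ht0 ht.2
  have hint : IntervalIntegrable g volume 0 t := by
    rw [ageMeasure_eq, ageSet_coe] at hgL2
    exact (intervalIntegrable_iff_integrableOn_Ioo_of_le ht0.le).2 (hgL2.integrable one_le_two)
  have hint_s : IntervalIntegrable g volume 0 s :=
    hint.mono_set (uIcc_subset_uIcc_left (by rw [uIcc_of_le ht0.le]; exact ⟨hs.1, hst⟩))
  have hnonpos : ∫ σ in s..t, g σ ≤ 0 := by
    rw [intervalIntegral.integral_of_le hst, integral_Ioc_eq_integral_Ioo]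
    refine integral_nonpos_of_ae (ae_restrict_of_ae_restrict_of_subset (fun σ hσ => ?_) hg)
    exact ⟨hs.1.trans_lt hσ.1, (EReal.coe_lt_coe hσ.2).trans_le ht.2⟩
  have hsub := intervalIntegral.integral_interval_sub_left hint hint_s
  have hfs := hprimitive s hs.1 (EReal.coe_le_coe hst)
  have hft := hprimitive t ht0.le le_rfl
  linarith

lemma CoeffAssumption.regularCoeffs {c : Coeffs} (hsbar : 0 < sbar)
    (hc : CoeffAssumption sbar c) : RegularCoeffs sbar c := by
  obtain ⟨_, hα, -⟩ := hc.alpha_mem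
  obtain ⟨_, hq, -⟩ := hc.q1_mem
  obtain ⟨g, hβ, hg⟩ := hc.beta1_mem
  obtain ⟨ε, hε, hle⟩ := hc.beta1_bound
  have hanti := antitoneOn_of_hasH1Deriv hβ hg
  have hsub : ∀ s ∈ ageSet sbar, 0 ≤ s ∧ (s : EReal) ≤ sbar := fun s hs => ⟨hs.1.le, hs.2.le⟩
  have hzero : (0 : ℝ) ∈ {s : ℝ | 0 ≤ s ∧ (s : EReal) ≤ sbar} :=
    ⟨le_rfl, by rw [EReal.coe_zero]; exact hsbar.le⟩
  refine ⟨hα.1, hq.1, memLp_top_of_bound (aemeasurable_restrict_of_antitoneOn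
    (measurableSet_ageSet sbar) (hanti.mono hsub)).aestronglyMeasurable (c.β1 0) ?_,
    ⟨ε, hε, ?_⟩, (hε.trans_le (hle 0 hzero.1 hzero.2)).trans_le hc.beta0_ge⟩
  · filter_upwards [ae_mem_ageSet sbar] with s hs
    rw [Real.norm_of_nonneg (hε.le.trans (hle s hs.1.le hs.2.le))]
    exact hanti hzero (hsub s hs) hs.1.le
  · filter_upwards [ae_mem_ageSet sbar] with s hs using hle s hs.1.le hs.2.le

end CoeffAssumption

section ConstantControl

variable {sbar : EReal}

lemma exp_smul_restrictAge_translate_integral (mu t : ℝ) (w : State sbar) :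
    Real.exp (-mu * t) • restrictAge sbar (translate t
      (∫ τ in (0 : ℝ)..t, translate (-τ) (extend sbar (Real.exp (mu * τ) • w)))) =
      ∫ σ in (0 : ℝ)..t, Real.exp (-mu * σ) • ageShift sbar σ w := by
  have hexp : Continuous fun τ => Real.exp (mu * τ) := by fun_prop
  have hcont : Continuous fun τ => translate (-τ) (extend sbar (Real.exp (mu * τ) • w)) :=
    continuous_translate.comp
      (continuous_neg.prodMk ((extend sbar).continuous.comp (hexp.smul continuous_const)))
  have hcomm := (restrictAge sbar ∘L (translate t).toContinuousLinearMap).intervalIntegral_comp_comm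
    (hcont.intervalIntegrable (μ := volume) 0 t)
  have hreverse := intervalIntegral.integral_comp_sub_left (a := 0) (b := t)
    (fun σ => Real.exp (-mu * σ) • ageShift sbar σ w) t
  rw [sub_self, sub_zero] at hreverse
  refine (congrArg (Real.exp (-mu * t) • ·) hcomm.symm).trans ?_
  rw [← hreverse, ← intervalIntegral.integral_smul]
  refine intervalIntegral.integral_congr fun τ _ => ?_
  simp only [ContinuousLinearMap.comp_apply, LinearIsometry.coe_toContinuousLinearMap, map_smul,
    smul_smul, translate_translate, ageShift_apply, ← Real.exp_add, ← sub_eq_add_neg]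
  ring_nf

lemma integral_exp_smul_ageShift_coeFn (mu : ℝ) {t : ℝ} (ht : 0 ≤ t) {f : ℝ → ℝ}
    (hf : MemLp f 2 (ageMeasure sbar)) :
    (∫ σ in (0 : ℝ)..t, Real.exp (-mu * σ) • ageShift sbar σ hf.toLp : State sbar)
      =ᵐ[ageMeasure sbar]
      fun s => ∫ σ in Ioc 0 t, Real.exp (-mu * σ) * (ageSet sbar).indicator f (s - σ) := by
  have hexp : Continuous fun σ : ℝ => Real.exp (-mu * σ) := by fun_prop
  have hsub : Measure.QuasiMeasurePreserving (fun p : ℝ × ℝ => p.2 - p.1)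
      (volume.prod volume) volume :=
    (quasiMeasurePreserving_sub_of_right_invariant volume volume).comp
      Measure.measurePreserving_swap.quasiMeasurePreserving
  rw [intervalIntegral.integral_of_le ht]
  refine coeFn_integral_Lp (g := fun σ s => Real.exp (-mu * σ) * (ageSet sbar).indicator f (s - σ))
    ((hexp.smul (continuous_ageShift hf.toLp)).integrableOn_Icc.mono_set Ioc_subset_Icc_self)
    ((hexp.comp continuous_fst).aestronglyMeasurable.mul
      (aestronglyMeasurable_indicator_comp hf.1 hsub _ _)) (Eventually.of_forall fun σ => ?_)
  filter_upwards [Lp.coeFn_smul (Real.exp (-mu * σ)) (ageShift sbar σ hf.toLp),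
    ageShift_toLp_coeFn σ hf] with s hsmul hshift
  rw [hsmul, Pi.smul_apply, hshift, smul_eq_mul]

lemma setIntegral_mul_indicator_ageSet_sub (g f : ℝ → ℝ) {s t : ℝ} (hs : s ∈ ageSet sbar)
    (ht : 0 ≤ t) : ∫ σ in Ioc 0 t, g σ * (ageSet sbar).indicator f (s - σ) =
      ∫ σ in (0 : ℝ)..min t s, g σ * f (s - σ) := by
  rw [intervalIntegral.integral_of_le (le_min ht hs.1.le), integral_Ioc_eq_integral_Ioo,
    integral_Ioc_eq_integral_Ioo, setIntegral_eq_of_subset_of_forall_sdiff_eq_zero measurableSet_Ioo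
      (Ioo_subset_Ioo_right (min_le_left t s))]
  · refine setIntegral_congr_fun measurableSet_Ioo fun σ hσ => ?_
    have hmem : s - σ ∈ ageSet sbar := ⟨sub_pos.2 (hσ.2.trans_le (min_le_right _ _)),
      (EReal.coe_le_coe (sub_le_self s hσ.1.le)).trans_lt hs.2⟩
    simp only [indicator_of_mem hmem]
  · rintro σ ⟨hσ, hσ'⟩
    have hmem : s - σ ∉ ageSet sbar := fun h => hσ' ⟨hσ.1, lt_min hσ.2 (sub_pos.1 h.1)⟩
    rw [indicator_of_notMem hmem, mul_zero]

lemma mildSolution_const_eq_add (mu : ℝ) (x : State sbar) {v : ℝ × State sbar}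
    (hu : LocallyAdmissible fun _ => v) (t : ℝ) :
    mildSolution mu x hu t = Real.exp (-mu * t) • (ageShift sbar t x + restrictAge sbar
      (translate t (memLp_boundaryProfile ((hu.exp_smul mu).fst t)).toLp)) +
      ∫ σ in (0 : ℝ)..t, Real.exp (-mu * σ) • ageShift sbar σ v.2 := by
  rw [← exp_smul_restrictAge_translate_integral, mildSolution, transportSolution, map_add, map_add,
    map_add, map_add, smul_add, ageShift_apply]
  rfl

lemma mildSolution_const_coeFn (mu b : ℝ) (x : State sbar) {f : ℝ → ℝ}
    (hf : MemLp f 2 (ageMeasure sbar)) (hu : LocallyAdmissible fun _ : ℝ => (b, hf.toLp)) {t : ℝ}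
    (ht : 0 ≤ t) : mildSolution mu x hu t =ᵐ[ageMeasure sbar] fun s =>
      (if t ≤ s then Real.exp (-mu * t) * x (s - t) else Real.exp (-mu * s) * b) +
        ∫ σ in (0 : ℝ)..min t s, Real.exp (-mu * σ) * f (s - σ) := by
  rw [mildSolution_const_eq_add]
  set z₁ := ageShift sbar t x
  set z₂ := restrictAge sbar (translate t (memLp_boundaryProfile ((hu.exp_smul mu).fst t)).toLp)
  filter_upwards [Lp.coeFn_add (Real.exp (-mu * t) • (z₁ + z₂))
      (∫ σ in (0 : ℝ)..t, Real.exp (-mu * σ) • ageShift sbar σ hf.toLp),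
    Lp.coeFn_smul (Real.exp (-mu * t)) (z₁ + z₂), Lp.coeFn_add z₁ z₂, ageShift_coeFn t x,
    restrictAge_translate_boundaryProfile_coeFn t ((hu.exp_smul mu).fst t),
    integral_exp_smul_ageShift_coeFn mu ht hf, ae_mem_ageSet sbar,
    ae_restrict_of_ae (Measure.ae_ne volume t)] with s hadd hsmul hadd' hz₁ hz₂ hinput hs hst
  rw [hadd, Pi.add_apply, hsmul, Pi.smul_apply, hadd', Pi.add_apply, hz₁, hz₂, hinput,
    setIntegral_mul_indicator_ageSet_sub _ _ hs ht, smul_eq_mul]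
  congr 1
  obtain hlt | hlt := hst.lt_or_gt
  · have hnot : s - t ∉ ageSet sbar := fun h => (sub_neg.2 hlt).not_gt h.1
    have hmem : t - s ∈ Ioc 0 t := ⟨sub_pos.2 hlt, sub_le_self t hs.1.le⟩
    rw [if_neg hlt.not_ge, indicator_of_notMem hnot, indicator_of_mem hmem, zero_add,
      Prod.smul_fst, smul_eq_mul, ← mul_assoc, ← Real.exp_add]
    ring_nf
  · have hmem : s - t ∈ ageSet sbar :=
      ⟨sub_pos.2 hlt, (EReal.coe_le_coe (sub_le_self s ht)).trans_lt hs.2⟩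
    have hnot : t - s ∉ Ioc 0 t := fun h => (sub_neg.2 hlt).not_gt h.1
    rw [if_pos hlt.le, indicator_of_mem hmem, indicator_of_notMem hnot, add_zero]

lemma optTrajectory_eq (sbar : EReal) (mu : ℝ) (c : Coeffs) (z0 : ℝ → ℝ) (t s : ℝ) :
    optTrajectory sbar mu c z0 t s =
      (if t ≤ s then Real.exp (-mu * t) * z0 (s - t)
        else Real.exp (-mu * s) * optBoundary sbar mu c) +
        ∫ σ in (0 : ℝ)..min t s, Real.exp (-mu * σ) * optDistributed sbar mu c (s - σ) := by
  rw [optTrajectory]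
  split_ifs with h
  · rw [min_eq_left h]
  · rw [min_eq_right (not_le.1 h).le]

end ConstantControl

end VintageCapital

end

open VintageCapital in
theorem mainTheorem11_general (sbar : EReal) (mu : ℝ) (c : Coeffs) (hρ : 0 < c.ρ)
    (hc : RegularCoeffs sbar c) (hmu : sbar = ⊤ → -mu < c.ρ) :
    (∀ (x : State sbar) (u : ℝ → ℝ × State sbar),
      Admissible sbar c.ρ u →
        ∃ y, IsMildSolution sbar mu x u y ∧
          (∀ y', IsMildSolution sbar mu x u y' → EqOn y' y (Ici 0)) ∧
          PayoffFinite c y u) ∧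
    (∀ x : State sbar,
      valueFunction sbar mu c x =
        ((explicitValue sbar mu c x : ℝ) : EReal)) ∧
    ∃ h : MemLp (optDistributed sbar mu c) 2
        (ageMeasure sbar),
      ∀ x : State sbar,
        IsOptimal sbar mu c x
          (fun _ => (optBoundary sbar mu c, h.toLp)) ∧
        (∀ u, IsOptimal sbar mu c x u →
          ∀ᵐ t ∂(volume.restrict (Ioi (0 : ℝ))),
            u t = (optBoundary sbar mu c, h.toLp)) ∧
        ∀ y, IsMildSolution sbar mu x
            (fun _ => (optBoundary sbar mu c, h.toLp)) y →
          ∀ t : ℝ, 0 ≤ t →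
            ∀ᵐ s ∂(ageMeasure sbar),
              y t s = optTrajectory sbar mu c (fun r => x r) t s := by
  have hpos : sbar = ⊤ → 0 < c.ρ + mu := fun h => neg_lt_iff_pos_add.1 (hmu h)
  have hadm := admissible_const hρ (hc.optControl hpos)
  refine ⟨fun x u hu => ?_, hc.valueFunction_eq hpos hρ, hc.memLp_optDistributed hpos,
    fun x => ⟨(hc.isOptimal_iff hpos hρ hadm).2 (.of_forall fun _ => rfl),
      fun u hu => (hc.isOptimal_iff hpos hρ hu.1).1 hu, fun y hy t ht => ?_⟩⟩
  · have hy := isMildSolution_mildSolution mu x hu.locallyAdmissible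
    exact ⟨_, hy, fun y' hy' => hy.eqOn hy', (hc.payoffFinite_and_payoff_eq hpos hρ hu hy).1⟩
  · rw [(isMildSolution_mildSolution mu x hadm.locallyAdmissible).eqOn hy ht]
    simp only [optTrajectory_eq]
    exact mildSolution_const_coeFn mu _ x _ hadm.locallyAdmissible ht

theorem mainTheorem11 (sbar : EReal) (hsbar : 0 < sbar) (mu : ℝ) (c : VintageCapital.Coeffs)
    (hρ : 0 < c.ρ) (hc : VintageCapital.CoeffAssumption sbar c)
    (hmu : sbar = ⊤ → -mu < c.ρ) :
    -- the control problem is well posed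
    (∀ (x : VintageCapital.State sbar) (u : ℝ → ℝ × VintageCapital.State sbar),
      VintageCapital.Admissible sbar c.ρ u →
        ∃ y, VintageCapital.IsMildSolution sbar mu x u y ∧
          (∀ y', VintageCapital.IsMildSolution sbar mu x u y' → Set.EqOn y' y (Set.Ici 0)) ∧
          VintageCapital.PayoffFinite c y u) ∧
    -- the value function is the explicit function `v`
    (∀ x : VintageCapital.State sbar,
      VintageCapital.valueFunction sbar mu c x =
        ((VintageCapital.explicitValue sbar mu c x : ℝ) : EReal)) ∧
    -- the unique optimal control and the optimal trajectory
    ∃ h : MeasureTheory.MemLp (VintageCapital.optDistributed sbar mu c) 2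
        (VintageCapital.ageMeasure sbar),
      ∀ x : VintageCapital.State sbar,
        VintageCapital.IsOptimal sbar mu c x
          (fun _ => (VintageCapital.optBoundary sbar mu c, h.toLp)) ∧
        (∀ u, VintageCapital.IsOptimal sbar mu c x u →
          ∀ᵐ t ∂(MeasureTheory.volume.restrict (Set.Ioi (0 : ℝ))),
            u t = (VintageCapital.optBoundary sbar mu c, h.toLp)) ∧
        ∀ y, VintageCapital.IsMildSolution sbar mu x
            (fun _ => (VintageCapital.optBoundary sbar mu c, h.toLp)) y →
          ∀ t : ℝ, 0 ≤ t →
            ∀ᵐ s ∂(VintageCapital.ageMeasure sbar),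
              y t s = VintageCapital.optTrajectory sbar mu c (fun r => x r) t s :=
  mainTheorem11_general sbar mu c hρ (hc.regularCoeffs hsbar) hmu
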